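/- **Setting.** Let $d\in\{2,3\}$. A Lipschitz domain is a bounded connected nonempty open set that is locally, in suitable Cartesian coordinates, the region below the graph of a Lipschitz function. Let $\widehat\Omega\subset\mathbb R^d$ be a Lipschitz domain, $F:\widehat\Omega\to\mathbb R^d$ bi-Lipschitz onto the open set $\Omega:=F(\widehat\Omega)$ with $\det(DF)>0$ a.e., and $\widetilde\Phi(\widehat q):=(\det(DF)^{-1}\,\widehat q)\circ F^{-1}$. Write $\langle\cdot,\cdot\rangle_\omega$ and $\|\cdot\|_\omega$ for the $L^2(\omega)$ scalar product and norm, and $\|\zeta\|_{H^{-1}(\Omega)}:=\sup\{\langle\zeta,v\rangle_\Omega: v\in H^1_0(\Omega),\ \|\nabla v\|_\Omega=1\}$. Let $V_h$ be a subspace of $H^1_0(\Omega)$. *Partitions of unity.* Let $\mathcal V_h$ be a finite set and $\psi_a\in W^{1,\infty}(\Omega)$ $(a\in\mathcal V_h)$ with $\sum_a\psi_a=1$ in $\Omega$, such that $\psi_a\in H^1_0(\Omega)$ implies $\psi_a\in V_h$, and such that the interior $\omega_a\subset\Omega$ of the support of $\psi_a$ is a Lipschitz domain. For each $a$ let $\mathcal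 V_h^a$ be a finite set and $\psi_b\in W^{1,\infty}(\omega_a)$ $(b\in\mathcal V_h^a)$ with $\sum_b\psi_b=1$ in $\omega_a$, such that the interior $\omega_b\subset\omega_a$ of the support of $\psi_b$ is a Lipschitz domain. The functions $\psi_a$, $\psi_b$ are identified with their continuous representatives on $\overline\Omega$, $\overline{\omega_a}$, and in products $\psi_a\psi_b$ the function $\psi_b$ is extended by zero to $\Omega$. (The objects indexed by $b$ may depend on $a$.) *Patchwise spaces.* For $(\omega,\psi)=(\omega_a,\psi_a)$ or $(\omega_b,\psi_a\psi_b)$: if $\psi\in H^1_0(\Omega)$, let $H^1_*(\omega)$ and $L^2_*(\omega)$ be the subspaces of mean-value-free functions in $H^1(\omega)$ and $L^2(\omega)$, and $\boldsymbol H_0(\mathrm{div},\omega):=\{\boldsymbol v\in \boldsymbol H(\mathrm{div},\omega):\boldsymbol v\cdot\boldsymbol n=0\text{ on }\partial\omega\}$; otherwise let $H^1_*(\omega):=\{v\in H^1(\omega): v=0\text{ on }\partial\omega\setminus\psi^{-1}(\{0\})\}$, $L^2_*(\omega):=L^2(\omega)$ and $\boldsymbol H_0(\mathrm{div},\omega):=\{\boldsymbol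 v\in \boldsymbol H(\mathrm{div},\omega):\boldsymbol v\cdot\boldsymbol n=0\text{ on }\partial\omega\cap\psi^{-1}(\{0\})\}$, with traces and (weak) normal traces in the usual sense. *Discrete spaces.* For each $a$ let $V_h^a\subset H^1_*(\omega_a)$ be a finite-dimensional subspace such that, whenever $\psi_a\psi_b\in H^1_0(\Omega)$, one has $\psi_b\in V_h^a+\mathbb R$ if $\psi_a\in H_0^1(\Omega)$ and $\psi_b\in V_h^a$ otherwise. For all $a$ and $b\in\mathcal V_h^a$ let $Q_h^{a,b}\subset L^2_*(\omega_b)$ and $\boldsymbol V_h^{a,b}\subset\boldsymbol H_0(\mathrm{div},\omega_b)$ be finite-dimensional subspaces with $\nabla\cdot\boldsymbol V_h^{a,b}=Q_h^{a,b}$, and let $Q_h\subset L^2(\Omega)$ be a subspace with $Q_h|_{\omega_b}\subseteq Q_h^{a,b}+\widetilde\Phi(\mathbb R)$ if $\psi_a\psi_b\in H^1_0(\Omega)$ and $Q_h|_{\omega_b}\subseteq Q_h^{a,b}$ otherwise. For $Q=Q_h$, $\omega=\Omega$ or $Q=Q_h^{a,b}$, $\omega=\omega_b$, let $\Upsilon_Q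 g\in Q$ denote the Petrov–Galerkin projection of $g\in L^2(\omega)$: $\langle\Upsilon_Qg,t\rangle_\omega=\langle g,t\rangle_\omega$ for all $t\in\widetilde\Phi^{-1}(Q)\circ F^{-1}$. *Equilibrated flux.* Let $f\in L^2(\Omega)$, let $u\in H^1_0(\Omega)$ satisfy $\langle\nabla u,\nabla v\rangle_\Omega=\langle f,v\rangle_\Omega$ for all $v\in H^1_0(\Omega)$, and let $u_h\in V_h$ satisfy $\langle\nabla u_h,\nabla v_h\rangle_\Omega=\langle f,v_h\rangle_\Omega$ for all $v_h\in V_h$. For each $a$ let $r_h^a\in V_h^a$ satisfy $$\langle\nabla r_h^a,\nabla v_h\rangle_{\omega_a}=\langle f,v_h\psi_a\rangle_{\omega_a}-\langle\nabla u_h,\nabla(v_h\psi_a)\rangle_{\omega_a}\quad\text{for all }v_h\in V_h^a.$$ For each $a$ and $b\in\mathcal V_h^a$ let $\boldsymbol\sigma_h^{a,b}$ be the minimizer of $\|\boldsymbol v_h+\psi_b(\psi_a\nabla u_h+\nabla r_h^a)\|_{\omega_b}$ among all $\boldsymbol v_h\in\boldsymbol V_h^{a,b}$ with $$\nabla\cdot\boldsymbol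 v_h=\Upsilon_{Q_h^{a,b}}\big(f\psi_a\psi_b-\nabla u_h\cdot\nabla(\psi_a\psi_b)-\nabla r_h^a\cdot\nabla\psi_b\big),$$ and let $\boldsymbol\sigma_h:=\sum_{a\in\mathcal V_h}\sum_{b\in\mathcal V_h^a}\boldsymbol\sigma_h^{a,b}$, each summand being extended by zero. **Proposition 8.1.** Then $\boldsymbol\sigma_h\in\boldsymbol H(\mathrm{div},\Omega)$, the projection $\Upsilon_{Q_h}(f-\nabla\cdot\boldsymbol\sigma_h)$ exists and is unique, and $$\|\nabla(u-u_h)\|_\Omega\le\|\boldsymbol\sigma_h+\nabla u_h\|_\Omega+\|(1-\Upsilon_{Q_h})(f-\nabla\cdot\boldsymbol\sigma_h)\|_{H^{-1}(\Omega)}.$$ -/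

import Mathlib

open MeasureTheory Filter Topology

noncomputable section

namespace EquilibratedFlux

/-- Euclidean space of dimension `d`. -/
abbrev Rd (d : ℕ) := EuclideanSpace ℝ (Fin d)

/-- The scalar space `L²(ω)`. -/
abbrev L2 {d : ℕ} (ω : Set (Rd d)) := Lp ℝ 2 (volume.restrict ω)

/-- The vector-valued space `[L²(ω)]ᵈ`. -/
abbrev L2Vec {d : ℕ} (ω : Set (Rd d)) := Lp (Rd d) 2 (volume.restrict ω)

/-- The `L²(ω)`-norm, with values in `[0, ∞]`. -/
def normL2 {d : ℕ} {X : Type*} [NormedAddCommGroup X] (ω : Set (Rd d)) (v : Rd d → X) : ENNReal :=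
  eLpNorm v 2 (volume.restrict ω)

/-! ### Lipschitz domains -/

/-- A bounded connected (in particular nonempty) open set that is, near each of its boundary points
and in suitable Cartesian coordinates, the set of points below the graph of a Lipschitz function.
The vector `e` is the vertical direction, `y - ⟪e, y⟫ e` is the horizontal part of `y`. -/
structure IsLipschitzDomain {d : ℕ} (ω : Set (Rd d)) : Prop where
  isOpen : IsOpen ω
  isBounded : Bornology.IsBounded ω
  isConnected : IsConnected ω
  graph : ∀ x ∈ frontier ω, ∃ e : Rd d, ‖e‖ = 1 ∧ ∃ ρ : ℝ, 0 < ρ ∧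
    ∃ (K : NNReal) (γ : Rd d → ℝ), LipschitzWith K γ ∧
      ∀ y ∈ Metric.ball x ρ, (y ∈ ω ↔ inner ℝ e y < γ (y - inner ℝ e y • e))

/-! ### Weak derivatives and Sobolev spaces -/

/-- `φ ∈ C_c^∞(ω)`. -/
def IsTestFun {d : ℕ} (ω : Set (Rd d)) (φ : Rd d → ℝ) : Prop :=
  ContDiff ℝ (⊤ : ℕ∞) φ ∧ HasCompactSupport φ ∧ tsupport φ ⊆ ω

/-- `G` is the weak gradient of `u` in the open set `ω`. -/
def HasWeakGrad {d : ℕ} (ω : Set (Rd d)) (u : Rd d → ℝ) (G : Rd d → Rd d) : Prop :=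
  LocallyIntegrableOn u ω ∧ LocallyIntegrableOn G ω ∧
    ∀ φ, IsTestFun ω φ → ∫ x in ω, u x • gradient φ x = - ∫ x in ω, φ x • G x

open Classical in
/-- The weak gradient of `u` in `ω` (unique up to null sets; zero if there is none). -/
def weakGrad {d : ℕ} (ω : Set (Rd d)) (u : Rd d → ℝ) : Rd d → Rd d :=
  if h : ∃ G, HasWeakGrad ω u G then h.choose else 0

/-- `g` is the weak divergence of `w` in the open set `ω`. -/
def HasWeakDiv {d : ℕ} (ω : Set (Rd d)) (w : Rd d → Rd d) (g : Rd d → ℝ) : Prop :=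
  LocallyIntegrableOn w ω ∧ LocallyIntegrableOn g ω ∧
    ∀ φ, IsTestFun ω φ → ∫ x in ω, inner ℝ (w x) (gradient φ x) = - ∫ x in ω, g x * φ x

/-- `u ∈ H¹(ω)`. -/
def MemH1 {d : ℕ} (ω : Set (Rd d)) (u : Rd d → ℝ) : Prop :=
  MemLp u 2 (volume.restrict ω) ∧ ∃ G, HasWeakGrad ω u G ∧ MemLp G 2 (volume.restrict ω)

/-- `u ∈ W^{1,∞}(ω)`. -/
def MemW1inf {d : ℕ} (ω : Set (Rd d)) (u : Rd d → ℝ) : Prop :=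
  MemLp u ⊤ (volume.restrict ω) ∧ ∃ G, HasWeakGrad ω u G ∧ MemLp G ⊤ (volume.restrict ω)

/-- The smooth functions `φ n` converge to `u` in the norm of `H¹(ω)`. -/
def TendstoH1 {d : ℕ} (ω : Set (Rd d)) (φ : ℕ → Rd d → ℝ) (u : Rd d → ℝ) : Prop :=
  Tendsto (fun n => normL2 ω (fun x => φ n x - u x)) atTop (𝓝 0) ∧
  Tendsto (fun n => normL2 ω (fun x => gradient (φ n) x - weakGrad ω u x)) atTop (𝓝 0)

/-- `u ∈ H₀¹(ω)`, the closure of `C_c^∞(ω)` in `H¹(ω)`. -/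
def MemH10 {d : ℕ} (ω : Set (Rd d)) (u : Rd d → ℝ) : Prop :=
  MemH1 ω u ∧ ∃ φ : ℕ → Rd d → ℝ, (∀ n, IsTestFun ω (φ n)) ∧ TendstoH1 ω φ u

/-- For `u ∈ H¹(ω)` on a bounded Lipschitz domain `ω` and a Borel set `Γ ⊆ ∂ω`: the trace of `u`
vanishes almost everywhere on `Γ` for the surface measure. The trace of `u` is the `L²(∂ω)`-limit
of the boundary values of any functions smooth up to the boundary converging to `u` in `H¹(ω)`. -/
def TraceZeroOn {d : ℕ} (ω : Set (Rd d)) (u : Rd d → ℝ) (Γ : Set (Rd d)) : Prop :=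
  ∃ φ : ℕ → Rd d → ℝ, (∀ n, ContDiff ℝ (⊤ : ℕ∞) (φ n)) ∧ TendstoH1 ω φ u ∧
    Tendsto (fun n => eLpNorm (φ n) 2 ((Measure.hausdorffMeasure ((d : ℝ) - 1)).restrict Γ))
      atTop (𝓝 0)

/-- For `w ∈ H(div, ω)` with divergence `g`, on a bounded Lipschitz domain `ω`, and `Γ ⊆ ∂ω`:
`w · n = 0` on `Γ` in the weak sense, that is, the Green formula has no boundary term for all
functions of `H¹(ω)` with zero trace on the rest of the boundary. -/
def NormalTraceZeroOn {d : ℕ} (ω : Set (Rd d)) (w : Rd d → Rd d) (g : Rd d → ℝ)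
    (Γ : Set (Rd d)) : Prop :=
  ∀ v, MemH1 ω v → TraceZeroOn ω v (frontier ω \ Γ) →
    (∫ x in ω, inner ℝ (w x) (weakGrad ω v x)) + ∫ x in ω, g x * v x = 0

/-- The dual norm on `H^{-1}(Ω)` of (the functional induced by) `ζ ∈ L²(Ω)`: the supremum of
`⟨ζ, v⟩` over `v ∈ H₀¹(Ω)` with `‖∇v‖ = 1`, with values in `[0, ∞]`. -/
def normHneg1 {d : ℕ} (Ω : Set (Rd d)) (ζ : Rd d → ℝ) : ENNReal :=
  ⨆ (v : Rd d → ℝ) (_ : MemH10 Ω v) (_ : normL2 Ω (weakGrad Ω v) = 1),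
    ENNReal.ofReal (∫ x in Ω, ζ x * v x)

/-! ### Patchwise Sobolev spaces

In these three definitions `ψ` is the function that decides between an interior patch
(`ψ ∈ H₀¹(Ω)`) and a boundary patch. -/

/-- `v ∈ H¹_*(ω)`. -/
def MemH1Star {d : ℕ} (Ω ω : Set (Rd d)) (ψ : Rd d → ℝ) (v : Rd d → ℝ) : Prop :=
  MemH1 ω v ∧ (MemH10 Ω ψ → ∫ x in ω, v x = 0) ∧
    (¬ MemH10 Ω ψ → TraceZeroOn ω v (frontier ω \ ψ ⁻¹' {0}))

/-- `v ∈ L²_*(ω)`. -/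
def MemL2Star {d : ℕ} (Ω ω : Set (Rd d)) (ψ : Rd d → ℝ) (v : Rd d → ℝ) : Prop :=
  MemLp v 2 (volume.restrict ω) ∧ (MemH10 Ω ψ → ∫ x in ω, v x = 0)

/-- `w ∈ H₀(div, ω)`. -/
def MemHdiv0 {d : ℕ} (Ω ω : Set (Rd d)) (ψ : Rd d → ℝ) (w : Rd d → Rd d) : Prop :=
  MemLp w 2 (volume.restrict ω) ∧ ∃ g : Rd d → ℝ, MemLp g 2 (volume.restrict ω) ∧
    HasWeakDiv ω w g ∧ (MemH10 Ω ψ → NormalTraceZeroOn ω w g (frontier ω)) ∧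
    (¬ MemH10 Ω ψ → NormalTraceZeroOn ω w g (frontier ω ∩ ψ ⁻¹' {0}))

/-! ### Geometry and partitions of unity -/

/-- The interior of the support of a function `ψ` given on the open set `U`. -/
def patch {d : ℕ} (U : Set (Rd d)) (ψ : Rd d → ℝ) : Set (Rd d) :=
  interior (closure {x ∈ U | ψ x ≠ 0}) ∩ U

/-- The parameter domain, the parametrization (relevant only on the parameter domain), the functions
`ψ a` for the nodes `a`, and the functions `φ a b` for the vertices `b` of the large patch of `a`. -/
structure Geometry (d : ℕ) (𝒱 : Type*) (𝒲 : 𝒱 → Type*) where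
  Ωhat : Set (Rd d)
  F : Rd d → Rd d
  ψ : 𝒱 → Rd d → ℝ
  φ : (a : 𝒱) → 𝒲 a → Rd d → ℝ

namespace Geometry

variable {d : ℕ} {𝒱 : Type*} {𝒲 : 𝒱 → Type*} (D : Geometry d 𝒱 𝒲)

/-- The physical domain `Ω = F(Ωhat)`. -/
def Ω : Set (Rd d) := D.F '' D.Ωhat

/-- The inverse `Ω → Ωhat` of the parametrization. -/
def Finv : Rd d → Rd d := Function.invFunOn D.F D.Ωhat

/-- The Jacobian determinant `det (DF)` on the parameter domain. -/
def detDF (x : Rd d) : ℝ := (fderiv ℝ D.F x).det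

/-- The scalar Piola transform `q̂ ↦ (det (DF)⁻¹ q̂) ∘ F⁻¹`. -/
def piola (qhat : Rd d → ℝ) : Rd d → ℝ :=
  fun x => (D.detDF (D.Finv x))⁻¹ * qhat (D.Finv x)

/-- The inverse of the scalar Piola transform, `q ↦ det (DF) (q ∘ F)`. -/
def piolaInv (q : Rd d → ℝ) : Rd d → ℝ :=
  fun y => D.detDF y * q (D.F y)

/-- The large patch of the node `a`. -/
def large (a : 𝒱) : Set (Rd d) := patch D.Ω (D.ψ a)

/-- The small patch of the vertex `b` of the large patch of `a`. -/
def small (a : 𝒱) (b : 𝒲 a) : Set (Rd d) := patch (D.large a) (D.φ a b)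

/-- The product `ψ_a ψ_b`, where `ψ_b` lives on (the closure of) the large patch of `a` and is
extended by zero. -/
def prod (a : 𝒱) (b : 𝒲 a) : Rd d → ℝ :=
  fun x => D.ψ a x * (closure (D.large a)).indicator (D.φ a b) x

end Geometry

/-- The discrete spaces: `Vh` in `L²(Ω)`, `Vloc a` on the large patches, `Q a b` and `V a b` on the
small patches, and the global space `Qh`. -/
structure Spaces {d : ℕ} {𝒱 : Type*} {𝒲 : 𝒱 → Type*} (D : Geometry d 𝒱 𝒲) where
  Vh : Submodule ℝ (L2 D.Ω)
  Vloc : (a : 𝒱) → Submodule ℝ (L2 (D.large a))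
  Q : (a : 𝒱) → (b : 𝒲 a) → Submodule ℝ (L2 (D.small a b))
  V : (a : 𝒱) → (b : 𝒲 a) → Submodule ℝ (L2Vec (D.small a b))
  Qh : Submodule ℝ (L2 D.Ω)

/-! ### The abstract assumptions -/

section Assumptions

variable {d : ℕ} {𝒱 : Type*} {𝒲 : 𝒱 → Type*} {D : Geometry d 𝒱 𝒲}

/-- General setting: `F` is a bi-Lipschitz map with positive Jacobian determinant from a Lipschitz
domain onto the open set `Ω`, and `Vh` is a subspace of `H₀¹(Ω)`. -/
structure GeneralSetting (S : Spaces D) : Prop where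
  lipschitz_dom : IsLipschitzDomain D.Ωhat
  lipschitz : ∃ K, LipschitzOnWith K D.F D.Ωhat
  lipschitz_inv : ∃ K : NNReal, ∀ x ∈ D.Ωhat, ∀ y ∈ D.Ωhat, dist x y ≤ K * dist (D.F x) (D.F y)
  isOpen : IsOpen D.Ω
  det_pos : ∀ᵐ y ∂(volume.restrict D.Ωhat), 0 < D.detDF y
  Vh_sub : ∀ v ∈ S.Vh, MemH10 D.Ω v

/-- The functions `ψ a` form a partition of unity over `Ω`; each of them is represented by its
continuous representative on the closure of `Ω`. -/
structure NodePartition [Fintype 𝒱] (S : Spaces D) : Prop where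
  mem : ∀ a, MemW1inf D.Ω (D.ψ a)
  cont : ∀ a, ContinuousOn (D.ψ a) (closure D.Ω)
  sum_eq_one : ∀ x ∈ D.Ω, ∑ a, D.ψ a x = 1
  patch_lipschitz : ∀ a, IsLipschitzDomain (D.large a)
  mem_Vh : ∀ a, MemH10 D.Ω (D.ψ a) → ∃ v ∈ S.Vh, v =ᵐ[volume.restrict D.Ω] D.ψ a

/-- The functions `φ a b` form a partition of unity over the large patch of `a`; each of them is
represented by its continuous representative on the closure of the large patch. -/
structure VertexPartition [∀ a, Fintype (𝒲 a)] (S : Spaces D) : Prop where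
  mem : ∀ a b, MemW1inf (D.large a) (D.φ a b)
  cont : ∀ a b, ContinuousOn (D.φ a b) (closure (D.large a))
  sum_eq_one : ∀ a, ∀ x ∈ D.large a, ∑ b, D.φ a b x = 1
  patch_lipschitz : ∀ a b, IsLipschitzDomain (D.small a b)
  Vloc_finite : ∀ a, FiniteDimensional ℝ (S.Vloc a)
  Vloc_sub : ∀ a, ∀ v ∈ S.Vloc a, MemH1Star D.Ω (D.large a) (D.ψ a) v
  mem_Vloc_interior : ∀ a b, MemH10 D.Ω (D.prod a b) → MemH10 D.Ω (D.ψ a) →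
    ∃ v ∈ S.Vloc a, ∃ c : ℝ, D.φ a b =ᵐ[volume.restrict (D.large a)] fun x => v x + c
  mem_Vloc_boundary : ∀ a b, MemH10 D.Ω (D.prod a b) → ¬ MemH10 D.Ω (D.ψ a) →
    ∃ v ∈ S.Vloc a, D.φ a b =ᵐ[volume.restrict (D.large a)] v

/-- The local and global discrete spaces for the equilibration. -/
structure EquilibrationSpaces (S : Spaces D) : Prop where
  Q_finite : ∀ a b, FiniteDimensional ℝ (S.Q a b)
  Q_sub : ∀ a b, ∀ q ∈ S.Q a b, MemL2Star D.Ω (D.small a b) (D.prod a b) q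
  V_finite : ∀ a b, FiniteDimensional ℝ (S.V a b)
  V_sub : ∀ a b, ∀ w ∈ S.V a b, MemHdiv0 D.Ω (D.small a b) (D.prod a b) w
  div_V_sub : ∀ a b, ∀ w ∈ S.V a b, ∃ q ∈ S.Q a b, HasWeakDiv (D.small a b) w q
  Q_sub_div : ∀ a b, ∀ q ∈ S.Q a b, ∃ w ∈ S.V a b, HasWeakDiv (D.small a b) w q
  Qh_interior : ∀ q ∈ S.Qh, ∀ a b, MemH10 D.Ω (D.prod a b) →
    ∃ q' ∈ S.Q a b, ∃ c : ℝ,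
      q =ᵐ[volume.restrict (D.small a b)] fun x => q' x + D.piola (fun _ => c) x
  Qh_boundary : ∀ q ∈ S.Qh, ∀ a b, ¬ MemH10 D.Ω (D.prod a b) →
    ∃ q' ∈ S.Q a b, q =ᵐ[volume.restrict (D.small a b)] q'

end Assumptions

/-! ### Model problem, projections, and equilibrated flux -/

section Flux

variable {d : ℕ} {𝒱 : Type*} {𝒲 : 𝒱 → Type*} {D : Geometry d 𝒱 𝒲}

/-- `u ∈ H₀¹(Ω)` is the weak solution of the Poisson problem with right-hand side `f`. -/
def IsWeakSolution (Ω : Set (Rd d)) (f u : L2 Ω) : Prop :=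
  MemH10 Ω u ∧ ∀ v, MemH10 Ω v →
    ∫ x in Ω, inner ℝ (weakGrad Ω u x) (weakGrad Ω v x) = ∫ x in Ω, f x * v x

/-- `uh ∈ Vh` is a Galerkin approximation. -/
def IsGalerkinSolution (S : Spaces D) (f uh : L2 D.Ω) : Prop :=
  uh ∈ S.Vh ∧ ∀ v ∈ S.Vh,
    ∫ x in D.Ω, inner ℝ (weakGrad D.Ω uh x) (weakGrad D.Ω v x) = ∫ x in D.Ω, f x * v x

/-- `p` is the Petrov-Galerkin projection of `g ∈ L²(ω)` into `Q ⊆ L²(ω)`, for `ω ⊆ Ω`; the test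
functions are `q̂ ∘ F⁻¹` with `q̂` in the image of `Q` under the inverse Piola transform. -/
def IsPGProjection (D : Geometry d 𝒱 𝒲) {ω : Set (Rd d)} (Q : Submodule ℝ (L2 ω)) (g : Rd d → ℝ)
    (p : L2 ω) : Prop :=
  p ∈ Q ∧ ∀ q ∈ Q,
    ∫ x in ω, p x * D.piolaInv q (D.Finv x) = ∫ x in ω, g x * D.piolaInv q (D.Finv x)

/-- `r ∈ Vloc a` is the discrete residual lifting on the large patch of `a`. -/
def IsResidualLifting (S : Spaces D) (f uh : L2 D.Ω) (a : 𝒱) (r : L2 (D.large a)) : Prop :=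
  r ∈ S.Vloc a ∧ ∀ v ∈ S.Vloc a,
    ∫ x in D.large a, inner ℝ (weakGrad (D.large a) r x) (weakGrad (D.large a) v x) =
      (∫ x in D.large a, f x * (v x * D.ψ a x)) -
        ∫ x in D.large a, inner ℝ (weakGrad D.Ω uh x)
          (weakGrad (D.large a) (fun y => v y * D.ψ a y) x)

/-- The datum `f ψ_a ψ_b - ∇u_h · ∇(ψ_a ψ_b) - ∇r_h^a · ∇ψ_b` on a small patch. -/
def localDatum (D : Geometry d 𝒱 𝒲) (f uh : L2 D.Ω) (a : 𝒱) (r : L2 (D.large a)) (b : 𝒲 a) :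
    Rd d → ℝ :=
  fun x => f x * D.prod a b x
    - inner ℝ (weakGrad D.Ω uh x) (weakGrad (D.small a b) (D.prod a b) x)
    - inner ℝ (weakGrad (D.large a) r x) (weakGrad (D.large a) (D.φ a b) x)

/-- The function `ψ_b (ψ_a ∇u_h + ∇r_h^a)` on a small patch. -/
def localTarget (D : Geometry d 𝒱 𝒲) (uh : L2 D.Ω) (a : 𝒱) (r : L2 (D.large a)) (b : 𝒲 a) :
    Rd d → Rd d :=
  fun x => D.φ a b x • (D.ψ a x • weakGrad D.Ω uh x + weakGrad (D.large a) r x)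

/-- `σ` is the equilibrated flux on the small patch of `a`, `b`: it minimizes
`‖w + ψ_b (ψ_a ∇u_h + ∇r_h^a)‖` among all `w ∈ V a b` whose divergence is the projection of the
local datum. -/
def IsLocalFlux (S : Spaces D) (f uh : L2 D.Ω) (a : 𝒱) (r : L2 (D.large a)) (b : 𝒲 a)
    (σ : L2Vec (D.small a b)) : Prop :=
  ∃ p : L2 (D.small a b), IsPGProjection D (S.Q a b) (localDatum D f uh a r b) p ∧
    σ ∈ S.V a b ∧ HasWeakDiv (D.small a b) σ p ∧
    ∀ w ∈ S.V a b, HasWeakDiv (D.small a b) w p →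
      normL2 (D.small a b) (fun x => σ x + localTarget D uh a r b x) ≤
        normL2 (D.small a b) (fun x => w x + localTarget D uh a r b x)

/-- The equilibrated flux: the sum over all nodes and vertices of the local fluxes, extended by zero
outside of the small patches. -/
def totalFlux [Fintype 𝒱] [∀ a, Fintype (𝒲 a)] (D : Geometry d 𝒱 𝒲)
    (σ : (a : 𝒱) → (b : 𝒲 a) → L2Vec (D.small a b)) : Rd d → Rd d :=
  fun x => ∑ a, ∑ b, (D.small a b).indicator (σ a b) x

end Flux

end EquilibratedFlux

end

open EquilibratedFlux

noncomputable section

namespace EquilibratedFlux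

variable {d : ℕ} {ω ω' : Set (Rd d)}


/-! ### Test functions -/

/-! Two facts combine. First, any flux `σ` in `H(div, Ω)` bounds the error. With `e = u - uh` and `v
= e / ‖∇e‖`, the weak formulation and the Green formula in `H₀¹` give `‖∇e‖ = ⟨∇e, ∇v⟩ = -⟨σ + ∇uh,
∇v⟩ + ⟨f - div σ, v⟩`. Cauchy-Schwarz bounds the first term and the dual norm the second
(`IsWeakSolution.error_le`).

Second, the projection of `f - div σ_h` is zero, so it may be subtracted inside the dual norm at no
cost. Write `g_ab` for the local datum and `p_ab` for its projection. The partitions of unity and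
their vanishing gradient sums give `∑ g_ab = f`, in which the lifted residuals cancel
(`sum_localDatum`). Since `div σ_h = ∑ p_ab`, it remains to test each `g_ab - p_ab` with `det(DF) ∘
F⁻¹ * q` for `q` in `Qh`. On a small patch `q` is a local function plus, for interior patches, the
Piola transform of a constant `c`. The local function is handled by the definition of the
projection. The other part turns the test function into `c` itself, so only means matter: `p_ab` has
mean zero by the choice of space, and `g_ab` by `setIntegral_localDatum_eq_zero`. The latter uses
the residual equation with `ψ_b - const` as test function and, for an interior node, the Galerkin
equation with `ψ_a`. The projection is unique because the Jacobian weight is positive almost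
everywhere.

The local fluxes glue to an element of `H(div, Ω)` since a test function of `Ω` vanishes on the part
of a patch boundary where the normal trace is free (`MemHdiv0.hasWeakDiv_indicator`,
`notMem_of_mem_frontier_small`).

The analytic input is the product rule `HasWeakGrad.mul`, proved by mollification, and the fact that
weak gradients vanish off the patches (`HasWeakGrad.ae_eq_zero_off_patch`), which needs patch
boundaries of measure zero. -/

theorem IsTestFun.mono {φ : Rd d → ℝ} (h : IsTestFun ω' φ) (hs : ω' ⊆ ω) : IsTestFun ω φ :=
  ⟨h.1, h.2.1, h.2.2.trans hs⟩

theorem IsTestFun.eq_zero {φ : Rd d → ℝ} (h : IsTestFun ω φ) {x : Rd d} (hx : x ∉ ω) : φ x = 0 :=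
  image_eq_zero_of_notMem_tsupport fun hx' => hx (h.2.2 hx')

theorem continuous_gradient {φ : Rd d → ℝ} (h : ContDiff ℝ (⊤ : ℕ∞) φ) :
    Continuous (gradient φ) :=
  (InnerProductSpace.toDual ℝ (Rd d)).symm.continuous.comp (h.continuous_fderiv (by simp))

theorem gradient_eq_zero_of_notMem_tsupport {φ : Rd d → ℝ} {x : Rd d} (hx : x ∉ tsupport φ) :
    gradient φ x = 0 := by
  have h : φ =ᶠ[𝓝 x] fun _ => (0 : ℝ) := notMem_tsupport_iff_eventuallyEq.mp hx
  rw [h.gradient_eq]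
  simp [gradient]

theorem IsTestFun.gradient_eq_zero {φ : Rd d → ℝ} (h : IsTestFun ω φ) {x : Rd d} (hx : x ∉ ω) :
    gradient φ x = 0 :=
  gradient_eq_zero_of_notMem_tsupport fun hx' => hx (h.2.2 hx')

theorem integrableOn_smul_of_tsupport {E : Type*} [NormedAddCommGroup E] [NormedSpace ℝ E]
    {φ : Rd d → ℝ} {K : Set (Rd d)} {G : Rd d → E} (hK : IsCompact K) (hKω : K ⊆ ω)
    (hφ : Continuous φ) (h0 : ∀ x ∉ K, φ x = 0) (hG : LocallyIntegrableOn G ω) :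
    IntegrableOn (fun x => φ x • G x) ω := by
  have h1 : IntegrableOn G K := hG.integrableOn_compact_subset hKω hK
  have h2 : IntegrableOn (fun x => φ x • G x) K :=
    IntegrableOn.continuousOn_smul (h1) hφ.continuousOn hK
  refine (integrableOn_iff_integrable_of_support_subset ?_ |>.mp h2).integrableOn
  intro x hx
  by_contra hxK
  simp [h0 x hxK] at hx

theorem IsTestFun.integrableOn_smul {E : Type*} [NormedAddCommGroup E] [NormedSpace ℝ E]
    {φ : Rd d → ℝ} (h : IsTestFun ω φ) {G : Rd d → E} (hG : LocallyIntegrableOn G ω) :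
    IntegrableOn (fun x => φ x • G x) ω :=
  integrableOn_smul_of_tsupport h.2.1 h.2.2 h.1.continuous
    (fun _ => image_eq_zero_of_notMem_tsupport) hG

theorem IsTestFun.integrableOn_inner_gradient
    {φ : Rd d → ℝ} (h : IsTestFun ω φ) {G : Rd d → Rd d} (hG : LocallyIntegrableOn G ω) :
    IntegrableOn (fun x => inner ℝ (G x) (gradient φ x)) ω := by
  have h1 : IntegrableOn G (tsupport φ) := hG.integrableOn_compact_subset h.2.2 h.2.1
  obtain ⟨C, hC⟩ := h.2.1.exists_bound_of_continuousOn (continuous_gradient h.1).continuousOn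
  have h2 : IntegrableOn (fun x => inner ℝ (G x) (gradient φ x)) (tsupport φ) := by
    refine (h1.norm.mul_const C).mono'
      (h1.aestronglyMeasurable.inner (continuous_gradient h.1).aestronglyMeasurable) ?_
    filter_upwards [ae_restrict_mem (isClosed_tsupport φ).measurableSet] with x hx
    exact (norm_inner_le_norm _ _).trans (mul_le_mul_of_nonneg_left (hC x hx) (norm_nonneg _))
  refine (integrableOn_iff_integrable_of_support_subset ?_ |>.mp h2).integrableOn
  intro x hx
  by_contra hxK
  rw [Function.mem_support, gradient_eq_zero_of_notMem_tsupport hxK, inner_zero_right] at hx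
  exact hx rfl

theorem IsTestFun.integrableOn_smul_gradient
    {φ : Rd d → ℝ} (h : IsTestFun ω φ) {u : Rd d → ℝ} (hu : LocallyIntegrableOn u ω) :
    IntegrableOn (fun x => u x • gradient φ x) ω := by
  have h1 : IntegrableOn u (tsupport φ) := hu.integrableOn_compact_subset h.2.2 h.2.1
  have h2 : IntegrableOn (fun x => u x • gradient φ x) (tsupport φ) :=
    IntegrableOn.smul_continuousOn h1 (continuous_gradient h.1).continuousOn h.2.1
  refine (integrableOn_iff_integrable_of_support_subset ?_ |>.mp h2).integrableOn
  intro x hx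
  by_contra hxK
  rw [Function.mem_support, gradient_eq_zero_of_notMem_tsupport hxK, smul_zero] at hx
  exact hx rfl

theorem setIntegral_eq_of_subset_of_zero {E : Type*} [NormedAddCommGroup E] [NormedSpace ℝ E]
    {f : Rd d → E} (hω : MeasurableSet ω) (hs : ω' ⊆ ω) (h0 : ∀ x ∉ ω', f x = 0) :
    ∫ x in ω', f x = ∫ x in ω, f x :=
  (setIntegral_eq_of_subset_of_forall_sdiff_eq_zero hω hs fun x hx => h0 x hx.2).symm

/-- The fundamental lemma of the calculus of variations. -/
theorem ae_eq_of_forall_testFun {E : Type*} [NormedAddCommGroup E] [NormedSpace ℝ E]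
    [CompleteSpace E] (hω : IsOpen ω) {G G' : Rd d → E}
    (hG : LocallyIntegrableOn G ω) (hG' : LocallyIntegrableOn G' ω)
    (h : ∀ φ, IsTestFun ω φ → ∫ x in ω, φ x • G x = ∫ x in ω, φ x • G' x) :
    G =ᵐ[volume.restrict ω] G' := by
  have key := hω.ae_eq_zero_of_integral_contDiff_smul_eq_zero (hG.sub hG') (by
    intro g h1 h2 h3
    have ht : IsTestFun ω g := ⟨h1, h2, h3⟩
    have e1 : ∫ x in ω, g x • (G - G') x = ∫ x, g x • (G - G') x := by
      refine setIntegral_eq_integral_of_forall_compl_eq_zero fun x hx => ?_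
      rw [ht.eq_zero hx, zero_smul]
    rw [← e1]
    simp only [Pi.sub_apply, smul_sub]
    rw [integral_sub (ht.integrableOn_smul hG) (ht.integrableOn_smul hG'), h g ht, sub_self])
  rw [EventuallyEq, ae_restrict_iff' hω.measurableSet]
  filter_upwards [key] with x hx hxω
  exact sub_eq_zero.mp (hx hxω)

theorem LocallyIntegrableOn.congr_ae {E : Type*} [NormedAddCommGroup E]
    {G G' : Rd d → E}
    (hG : LocallyIntegrableOn G ω) (h : G =ᵐ[volume.restrict ω] G') :
    LocallyIntegrableOn G' ω := by
  intro x hx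
  obtain ⟨s, hs, hi⟩ := hG x hx
  refine ⟨s ∩ ω, inter_mem hs self_mem_nhdsWithin, ?_⟩
  exact (hi.mono_set Set.inter_subset_left).congr (ae_mono (Measure.restrict_mono_set _
    Set.inter_subset_right) h)

/-! ### Weak gradients -/

theorem HasWeakGrad.congr {u u' : Rd d → ℝ} {G G' : Rd d → Rd d}
    (h : HasWeakGrad ω u G) (hu : u =ᵐ[volume.restrict ω] u') (hG : G =ᵐ[volume.restrict ω] G') :
    HasWeakGrad ω u' G' := by
  refine ⟨LocallyIntegrableOn.congr_ae h.1 hu,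
    LocallyIntegrableOn.congr_ae h.2.1 hG, fun φ hφ => ?_⟩
  have e1 : ∫ x in ω, u' x • gradient φ x = ∫ x in ω, u x • gradient φ x :=
    integral_congr_ae (by filter_upwards [hu] with x hx; rw [hx])
  have e2 : ∫ x in ω, φ x • G' x = ∫ x in ω, φ x • G x :=
    integral_congr_ae (by filter_upwards [hG] with x hx; rw [hx])
  rw [e1, e2, h.2.2 φ hφ]

theorem HasWeakGrad.unique (hω : IsOpen ω) {u u' : Rd d → ℝ} {G G' : Rd d → Rd d}
    (h : HasWeakGrad ω u G) (h' : HasWeakGrad ω u' G') (hu : u =ᵐ[volume.restrict ω] u') :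
    G =ᵐ[volume.restrict ω] G' := by
  refine ae_eq_of_forall_testFun hω h.2.1 h'.2.1 fun φ hφ => ?_
  have := (h.congr hu EventuallyEq.rfl).2.2 φ hφ
  rw [h'.2.2 φ hφ] at this
  exact (neg_injective this).symm

theorem HasWeakGrad.weakGrad {u : Rd d → ℝ} {G : Rd d → Rd d} (h : HasWeakGrad ω u G) :
    HasWeakGrad ω u (weakGrad ω u) := by
  have h' : ∃ G, HasWeakGrad ω u G := ⟨G, h⟩
  rw [EquilibratedFlux.weakGrad, dif_pos h']
  exact h'.choose_spec

theorem HasWeakGrad.ae_eq (hω : IsOpen ω) {u : Rd d → ℝ} {G : Rd d → Rd d}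
    (h : HasWeakGrad ω u G) : EquilibratedFlux.weakGrad ω u =ᵐ[volume.restrict ω] G :=
  h.weakGrad.unique hω h EventuallyEq.rfl

theorem HasWeakGrad.mono (hω : IsOpen ω) (hs : ω' ⊆ ω) {u : Rd d → ℝ}
    {G : Rd d → Rd d} (h : HasWeakGrad ω u G) : HasWeakGrad ω' u G := by
  refine ⟨h.1.mono_set hs, h.2.1.mono_set hs, fun φ hφ => ?_⟩
  rw [setIntegral_eq_of_subset_of_zero hω.measurableSet hs, h.2.2 φ (hφ.mono hs),
    setIntegral_eq_of_subset_of_zero hω.measurableSet hs]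
  · intro x hx
    rw [hφ.eq_zero hx, zero_smul]
  · intro x hx
    rw [hφ.gradient_eq_zero hx, smul_zero]

theorem HasWeakGrad.add {u v : Rd d → ℝ} {G H : Rd d → Rd d}
    (h : HasWeakGrad ω u G) (h' : HasWeakGrad ω v H) :
    HasWeakGrad ω (fun x => u x + v x) (fun x => G x + H x) := by
  refine ⟨h.1.add h'.1, h.2.1.add h'.2.1, fun φ hφ => ?_⟩
  simp only [add_smul, smul_add]
  rw [integral_add (hφ.integrableOn_smul_gradient h.1) (hφ.integrableOn_smul_gradient h'.1),
    integral_add (hφ.integrableOn_smul h.2.1) (hφ.integrableOn_smul h'.2.1), h.2.2 φ hφ,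
    h'.2.2 φ hφ, neg_add]

theorem HasWeakGrad.const_mul {u : Rd d → ℝ} {G : Rd d → Rd d}
    (h : HasWeakGrad ω u G) (c : ℝ) :
    HasWeakGrad ω (fun x => c * u x) (fun x => c • G x) := by
  refine ⟨h.1.smul c, h.2.1.smul c, fun φ hφ => ?_⟩
  simp only [mul_smul]
  simp only [smul_comm _ c]
  rw [integral_smul, integral_smul, h.2.2 φ hφ, smul_neg]

theorem HasWeakGrad.sub {u v : Rd d → ℝ} {G H : Rd d → Rd d}
    (h : HasWeakGrad ω u G) (h' : HasWeakGrad ω v H) :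
    HasWeakGrad ω (fun x => u x - v x) (fun x => G x - H x) := by
  have := h.add (h'.const_mul (-1))
  simpa [sub_eq_add_neg] using this

theorem HasWeakGrad.zero : HasWeakGrad ω (fun _ => 0) (fun _ => 0) :=
  ⟨locallyIntegrableOn_zero, locallyIntegrableOn_zero, fun φ _ => by simp⟩

theorem HasWeakGrad.sum {ι : Type*} (s : Finset ι) {u : ι → Rd d → ℝ} {G : ι → Rd d → Rd d}
    (h : ∀ i, HasWeakGrad ω (u i) (G i)) :
    HasWeakGrad ω (fun x => ∑ i ∈ s, u i x) (fun x => ∑ i ∈ s, G i x) := by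
  classical
  induction s using Finset.induction_on with
  | empty => simpa using HasWeakGrad.zero
  | insert i s hi ih => simpa [Finset.sum_insert hi] using (h i).add ih

theorem HasWeakGrad.of_contDiff {u : Rd d → ℝ} (hu : ContDiff ℝ (⊤ : ℕ∞) u) :
    HasWeakGrad ω u (gradient u) := by
  have l1 : LocallyIntegrableOn u ω := hu.continuous.locallyIntegrable.locallyIntegrableOn ω
  have l2 : LocallyIntegrableOn (gradient u) ω :=
    (continuous_gradient hu).locallyIntegrable.locallyIntegrableOn ω
  refine ⟨l1, l2, fun φ hφ => ?_⟩
  -- Pairing with a fixed vector `e` reduces the vector identity to scalar integration by parts in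
  -- direction `e`. The compact support of `φ` allows integrating over the whole space.
  refine ext_inner_left ℝ fun e => ?_
  have i1 := hφ.integrableOn_smul_gradient l1
  have i2 := hφ.integrableOn_smul l2
  rw [inner_neg_right, ← integral_inner i1, ← integral_inner i2]
  simp only [inner_smul_right]
  rw [setIntegral_eq_integral_of_forall_compl_eq_zero
      fun x hx => by rw [hφ.gradient_eq_zero hx]; simp,
    setIntegral_eq_integral_of_forall_compl_eq_zero fun x hx => by rw [hφ.eq_zero hx]; simp]
  have hg : ∀ (f : Rd d → ℝ) x, inner ℝ e (gradient f x) = fderiv ℝ f x e := fun f x => by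
    rw [real_inner_comm, inner_gradient_left]
  simp only [hg]
  have hdu := hu.differentiable (by simp)
  have hdφ := hφ.1.differentiable (by simp)
  have cu : Continuous fun x => fderiv ℝ u x e :=
    (hu.continuous_fderiv (by simp)).clm_apply continuous_const
  have cφ : Continuous fun x => fderiv ℝ φ x e :=
    (hφ.1.continuous_fderiv (by simp)).clm_apply continuous_const
  rw [integral_mul_fderiv_eq_neg_fderiv_mul_of_integrable]
  · simp only [mul_comm]
  · exact (cu.mul hφ.1.continuous).integrable_of_hasCompactSupport hφ.2.1.mul_left
  · exact (hu.continuous.mul cφ).integrable_of_hasCompactSupport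
      (HasCompactSupport.mul_left (hφ.2.1.fderiv_apply ℝ e))
  · exact (hu.continuous.mul hφ.1.continuous).integrable_of_hasCompactSupport hφ.2.1.mul_left
  · exact fun x _ => hdu x
  · exact fun x _ => hdφ x

theorem HasWeakGrad.const (c : ℝ) : HasWeakGrad ω (fun _ => c) (fun _ => 0) := by
  have := HasWeakGrad.of_contDiff (ω := ω) (u := fun _ : Rd d => c) contDiff_const
  simpa [gradient_fun_const'] using this


/-! ### Mollification and the product rule -/

open scoped Convolution

/-- The mollification of `g` with the normalized bump function `ρ`. -/
def mollify {E : Type*} [NormedAddCommGroup E] [NormedSpace ℝ E] (ρ : ContDiffBump (0 : Rd d))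
    (g : Rd d → E) : Rd d → E :=
  (ρ.normed volume) ⋆[ContinuousLinearMap.lsmul ℝ ℝ, volume] g

theorem mollify_apply {E : Type*} [NormedAddCommGroup E] [NormedSpace ℝ E]
    (ρ : ContDiffBump (0 : Rd d)) (g : Rd d → E) (x : Rd d) :
    mollify ρ g x = ∫ t, ρ.normed volume (x - t) • g t :=
  convolution_eq_swap _

/-- Averaging against a nonnegative kernel of mass one cannot exceed an essential bound. This makes
the mollifications dominated uniformly in the radius. -/
theorem norm_mollify_le {E : Type*} [NormedAddCommGroup E] [NormedSpace ℝ E]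
    (ρ : ContDiffBump (0 : Rd d)) {g : Rd d → E} {C : ℝ} (hC : ∀ᵐ x, ‖g x‖ ≤ C) (x : Rd d) :
    ‖mollify ρ g x‖ ≤ C := by
  rw [mollify_apply]
  have hi : Integrable (fun t => ρ.normed volume (x - t)) volume :=
    (ρ.integrable_normed (μ := volume)).comp_sub_left x
  have h1 : ∫ t, ρ.normed volume (x - t) * C = C := by
    rw [integral_mul_const, integral_sub_left_eq_self (fun t => ρ.normed volume t) volume x,
      ρ.integral_normed, one_mul]
  refine (norm_integral_le_of_norm_le (hi.mul_const C) ?_).trans_eq h1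
  filter_upwards [hC] with t ht
  rw [norm_smul, Real.norm_of_nonneg (ρ.nonneg_normed _)]
  exact mul_le_mul_of_nonneg_left ht (ρ.nonneg_normed _)

theorem contDiff_mollify (ρ : ContDiffBump (0 : Rd d)) {g : Rd d → ℝ}
    (hg : LocallyIntegrable g volume) : ContDiff ℝ (⊤ : ℕ∞) (mollify ρ g) :=
  ρ.hasCompactSupport_normed.contDiff_convolution_left _ ρ.contDiff_normed hg

theorem integrable_reflect_smul {E : Type*} [NormedAddCommGroup E] [NormedSpace ℝ E]
    {g : Rd d → E} (hg : LocallyIntegrable g volume)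
    {χ : Rd d → ℝ} (hχ : Continuous χ) (hχc : HasCompactSupport χ) (x : Rd d) :
    Integrable (fun t => χ (x - t) • g t) volume := by
  refine hg.integrable_smul_left_of_hasCompactSupport (hχ.comp (by fun_prop)) ?_
  exact hχc.comp_homeomorph (Homeomorph.subLeft x)

/-- Well inside of `ω`, mollification commutes with the weak gradient. -/
theorem gradient_mollify (hω : IsOpen ω) {v : Rd d → ℝ} {V : Rd d → Rd d}
    (h : HasWeakGrad ω v V) (hv : LocallyIntegrable (ω.indicator v) volume)
    (hV : LocallyIntegrable (ω.indicator V) volume) (ρ : ContDiffBump (0 : Rd d)) {x : Rd d}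
    (hx : Metric.closedBall x ρ.rOut ⊆ ω) :
    gradient (mollify ρ (ω.indicator v)) x = mollify ρ (ω.indicator V) x := by
  -- The reflected kernel is supported in the closed ball around `x`, hence in `ω`, so it is a
  -- legitimate test function for `v`. The reflection costs one sign, which cancels the sign in the
  -- definition of the weak gradient.
  set χ : Rd d → ℝ := fun t => ρ.normed volume (x - t) with hχ
  have hρ : ContDiff ℝ (⊤ : ℕ∞) (ρ.normed volume) := ρ.contDiff_normed
  have hχtest : IsTestFun ω χ := by
    refine ⟨hρ.comp (by fun_prop), ρ.hasCompactSupport_normed.comp_homeomorph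
      (Homeomorph.subLeft x), ?_⟩
    refine (closure_minimal ?_ Metric.isClosed_closedBall).trans hx
    intro t ht
    have : x - t ∈ Function.support (ρ.normed volume) := ht
    rw [ρ.support_normed_eq] at this
    rw [mem_ball_zero_iff, ← dist_eq_norm, dist_comm] at this
    exact this.le
  have hgχ : ∀ t e, inner ℝ (gradient χ t) e = - fderiv ℝ (ρ.normed volume) (x - t) e := by
    intro t e
    rw [inner_gradient_left]
    have h1 : HasFDerivAt χ ((fderiv ℝ (ρ.normed volume) (x - t)).comp
        (-(ContinuousLinearMap.id ℝ (Rd d)))) t :=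
      ((hρ.differentiable (by simp)) (x - t)).hasFDerivAt.comp t
        ((hasFDerivAt_id t).const_sub x)
    rw [h1.fderiv]
    simp
  refine ext_inner_right ℝ fun e => ?_
  rw [inner_gradient_left]
  have hder := HasCompactSupport.hasFDerivAt_convolution_left
    (ContinuousLinearMap.lsmul ℝ ℝ) (ρ.hasCompactSupport_normed (μ := volume))
    (ρ.contDiff_normed (n := 1)) hv x
  rw [show mollify ρ (ω.indicator v) = (ρ.normed volume)
    ⋆[ContinuousLinearMap.lsmul ℝ ℝ, volume] (ω.indicator v) from rfl, hder.fderiv,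
    convolution_eq_swap, mollify_apply]
  have hfc : Continuous (fderiv ℝ (ρ.normed volume)) := hρ.continuous_fderiv (by simp)
  have hint : Integrable (fun t => (ContinuousLinearMap.precompL (Rd d)
      (ContinuousLinearMap.lsmul ℝ ℝ)) (fderiv ℝ (ρ.normed volume) (x - t))
        (ω.indicator v t)) volume := by
    have := ((ρ.hasCompactSupport_normed (μ := volume)).fderiv ℝ).convolutionExists_left
      (ContinuousLinearMap.precompL (Rd d) (ContinuousLinearMap.lsmul ℝ ℝ)) hfc hv x
    exact this.integrable_swap
  rw [ContinuousLinearMap.integral_apply hint, real_inner_comm,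
    ← integral_inner (integrable_reflect_smul hV hρ.continuous ρ.hasCompactSupport_normed x)]
  have key := congrArg (fun z => inner ℝ e z) (h.2.2 χ hχtest)
  simp only [inner_neg_right] at key
  rw [← integral_inner (hχtest.integrableOn_smul_gradient h.1),
    ← integral_inner (hχtest.integrableOn_smul h.2.1)] at key
  have e1 : ∀ t, ((ContinuousLinearMap.precompL (Rd d)
      (ContinuousLinearMap.lsmul ℝ ℝ)) (fderiv ℝ (ρ.normed volume) (x - t))
        (ω.indicator v t)) e = - ω.indicator (fun t => inner ℝ e (v t • gradient χ t)) t := by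
    intro t
    by_cases ht : t ∈ ω
    · simp only [Set.indicator_of_mem ht, inner_smul_right]
      rw [real_inner_comm, hgχ]
      simp [mul_comm]
    · simp [Set.indicator_of_notMem ht]
  have e2 : ∀ t, inner ℝ e (ρ.normed volume (x - t) • ω.indicator V t)
      = ω.indicator (fun t => inner ℝ e (χ t • V t)) t := by
    intro t
    by_cases ht : t ∈ ω
    · simp [Set.indicator_of_mem ht, hχ]
    · simp [Set.indicator_of_notMem ht]
  simp only [e1, e2]
  rw [integral_neg, integral_indicator hω.measurableSet, integral_indicator hω.measurableSet, key,
    neg_neg]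

theorem locallyIntegrableOn_of_memLp {E : Type*} [NormedAddCommGroup E] {p : ENNReal}
    (hp : 1 ≤ p) {g : Rd d → E} (h : MemLp g p (volume.restrict ω)) :
    LocallyIntegrableOn g ω :=
  locallyIntegrableOn_of_locallyIntegrable_restrict (h.locallyIntegrable hp)

theorem exists_ae_bound_of_memLp_top {E : Type*} [NormedAddCommGroup E]
    {μ : Measure (Rd d)} {g : Rd d → E} (h : MemLp g ⊤ μ) :
    ∃ C : ℝ, ∀ᵐ x ∂μ, ‖g x‖ ≤ C := by
  refine ⟨(eLpNormEssSup g μ).toReal, ?_⟩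
  have hlt : eLpNormEssSup g μ < ⊤ := by simpa using h.2
  filter_upwards [ae_le_eLpNormEssSup (f := g) (μ := μ)] with x hx
  rw [← toReal_enorm]
  exact ENNReal.toReal_mono hlt.ne hx

/-- Lebesgue differentiation, with a single sequence of kernels that serves the function and its
gradient simultaneously. -/
theorem exists_ae_tendsto_mollify (δ : ℝ) (hδ : 0 < δ) {v : Rd d → ℝ} {V : Rd d → Rd d}
    (hv : LocallyIntegrable v volume) (hV : LocallyIntegrable V volume) :
    ∃ ρ : ℕ → ContDiffBump (0 : Rd d), (∀ n, (ρ n).rOut ≤ δ) ∧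
      (∀ᵐ x, Tendsto (fun n => mollify (ρ n) v x) atTop (𝓝 (v x))) ∧
      (∀ᵐ x, Tendsto (fun n => mollify (ρ n) V x) atTop (𝓝 (V x))) := by
  have hpos : ∀ n : ℕ, 0 < δ / ((n : ℝ) + 1) := fun n => by positivity
  -- The outer radius is exactly twice the inner one: a bounded ratio is what almost everywhere
  -- convergence requires.
  let ρ : ℕ → ContDiffBump (0 : Rd d) := fun n =>
    ⟨δ / ((n : ℝ) + 1) / 2, δ / ((n : ℝ) + 1), half_pos (hpos n), half_lt_self (hpos n)⟩
  have hlim : Tendsto (fun n => (ρ n).rOut) atTop (𝓝 0) := by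
    have h1 := (tendsto_one_div_add_atTop_nhds_zero_nat (𝕜 := ℝ)).const_mul δ
    simpa [ρ, div_eq_mul_inv] using h1
  have hK : ∀ᶠ n in atTop, (ρ n).rOut ≤ 2 * (ρ n).rIn :=
    Eventually.of_forall fun n => by simp only [ρ]; linarith
  refine ⟨ρ, fun n => ?_, ?_, ?_⟩
  · exact div_le_self hδ.le (by simp)
  · exact ContDiffBump.ae_convolution_tendsto_right_of_locallyIntegrable hlim hK hv
  · exact ContDiffBump.ae_convolution_tendsto_right_of_locallyIntegrable hlim hK hV

theorem gradient_mul {φ g : Rd d → ℝ} {x : Rd d} (hφ : DifferentiableAt ℝ φ x)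
    (hg : DifferentiableAt ℝ g x) :
    gradient (fun y => φ y * g y) x = φ x • gradient g x + g x • gradient φ x := by
  refine ext_inner_right ℝ fun e => ?_
  rw [inner_add_left, inner_smul_left, inner_smul_left, inner_gradient_left, inner_gradient_left,
    inner_gradient_left, fderiv_fun_mul hφ hg]
  simp

/-- The product rule for bounded functions with bounded weak gradients. -/
theorem HasWeakGrad.mul (hω : IsOpen ω) {u v : Rd d → ℝ} {U V : Rd d → Rd d}
    (hu : HasWeakGrad ω u U) (hv : HasWeakGrad ω v V)
    (bu : MemLp u ⊤ (volume.restrict ω)) (bU : MemLp U ⊤ (volume.restrict ω))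
    (bv : MemLp v ⊤ (volume.restrict ω)) (bV : MemLp V ⊤ (volume.restrict ω)) :
    HasWeakGrad ω (fun x => u x * v x) (fun x => u x • V x + v x • U x) := by
  have buv : MemLp (fun x => u x * v x) ⊤ (volume.restrict ω) := bv.mul bu
  have buV : MemLp (fun x => u x • V x) ⊤ (volume.restrict ω) := bV.smul bu
  have bvU : MemLp (fun x => v x • U x) ⊤ (volume.restrict ω) := bU.smul bv
  have luv := locallyIntegrableOn_of_memLp le_top buv
  have luV := locallyIntegrableOn_of_memLp le_top buV
  have lvU := locallyIntegrableOn_of_memLp le_top bvU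
  refine ⟨luv, luV.add lvU, fun φ hφ => ?_⟩
  have bv' : MemLp (ω.indicator v) ⊤ volume :=
    (memLp_indicator_iff_restrict hω.measurableSet).mpr bv
  have bV' : MemLp (ω.indicator V) ⊤ volume :=
    (memLp_indicator_iff_restrict hω.measurableSet).mpr bV
  have lv' : LocallyIntegrable (ω.indicator v) volume := bv'.locallyIntegrable le_top
  have lV' : LocallyIntegrable (ω.indicator V) volume := bV'.locallyIntegrable le_top
  obtain ⟨C, hC⟩ := exists_ae_bound_of_memLp_top bv'
  obtain ⟨C', hC'⟩ := exists_ae_bound_of_memLp_top bV'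
  have hcpt : IsCompact (tsupport φ) := hφ.2.1
  obtain ⟨δ, hδ, hKω⟩ := hcpt.exists_cthickening_subset_open hω hφ.2.2
  obtain ⟨ρ, hρ, hlim, hLim⟩ := exists_ae_tendsto_mollify δ hδ lv' lV'
  have hsm : ∀ n, ContDiff ℝ (⊤ : ℕ∞) (mollify (ρ n) (ω.indicator v)) := fun n => contDiff_mollify _ lv'
  -- Only `v` is mollified. Then `φ` times the mollification is smooth with support in that of `φ`,
  -- and can be inserted into the definition of the weak gradient of `u`.
  have htest : ∀ n, IsTestFun ω fun x => φ x * mollify (ρ n) (ω.indicator v) x := fun n =>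
    ⟨hφ.1.mul (hsm n), hφ.2.1.mul_right, (tsupport_mul_subset_left).trans hφ.2.2⟩
  have hgrad : ∀ n x, gradient (fun x => φ x * mollify (ρ n) (ω.indicator v) x) x =
      φ x • mollify (ρ n) (ω.indicator V) x + mollify (ρ n) (ω.indicator v) x • gradient φ x := by
    intro n x
    rw [gradient_mul (hφ.1.differentiable (by simp) x) ((hsm n).differentiable (by simp) x)]
    -- On the support of `φ` the radius `δ` keeps the mollification ball inside `ω`; elsewhere the
    -- factor `φ` removes the term in question.
    by_cases hx : x ∈ tsupport φ
    · rw [gradient_mollify hω hv lv' lV']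
      refine (Metric.closedBall_subset_closedBall (hρ n)).trans ?_
      exact (Metric.closedBall_subset_cthickening hx δ).trans hKω
    · rw [image_eq_zero_of_notMem_tsupport hx, zero_smul, zero_smul]
  have heq : ∀ n, ∫ x in ω, (φ x * u x) • mollify (ρ n) (ω.indicator V) x
        + (u x * mollify (ρ n) (ω.indicator v) x) • gradient φ x
      = - ∫ x in ω, (φ x * mollify (ρ n) (ω.indicator v) x) • U x := by
    intro n
    rw [← hu.2.2 _ (htest n)]
    refine integral_congr_ae (Eventually.of_forall fun x => ?_)
    simp only [hgrad, smul_add, smul_smul, mul_comm (u x) (φ x)]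
  have aeω : ∀ {p : Rd d → Prop}, (∀ᵐ x, p x) → ∀ᵐ x ∂volume.restrict ω, p x :=
    fun h => ae_restrict_of_ae h
  have su := hu.1.aestronglyMeasurable
  have sU := hu.2.1.aestronglyMeasurable
  have sφ := hφ.1.continuous.aestronglyMeasurable (μ := volume.restrict ω)
  have sgφ := (continuous_gradient hφ.1).aestronglyMeasurable (μ := volume.restrict ω)
  have sv : ∀ n, AEStronglyMeasurable (mollify (ρ n) (ω.indicator v)) (volume.restrict ω) := fun n =>
    (hsm n).continuous.aestronglyMeasurable
  have sV : ∀ n, AEStronglyMeasurable (mollify (ρ n) (ω.indicator V)) (volume.restrict ω) := fun n => by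
    have hc : ContDiff ℝ (⊤ : ℕ∞) (mollify (ρ n) (ω.indicator V)) :=
      (ρ n).hasCompactSupport_normed.contDiff_convolution_left _ (ρ n).contDiff_normed lV'
    exact hc.continuous.aestronglyMeasurable
  -- Both sides of `heq` converge by dominated convergence, because `u` and `U` are integrable
  -- against `φ` and the mollifications are bounded by `C` and `C'`.
  have hL : Tendsto (fun n => ∫ x in ω, (φ x * u x) • mollify (ρ n) (ω.indicator V) x
        + (u x * mollify (ρ n) (ω.indicator v) x) • gradient φ x) atTop
      (𝓝 (∫ x in ω, (φ x * u x) • V x + (u x * v x) • gradient φ x)) := by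
    refine tendsto_integral_of_dominated_convergence
      (fun x => ‖φ x • u x‖ * C' + C * ‖u x • gradient φ x‖) ?_ ?_ ?_ ?_
    · intro n
      exact ((sφ.mul su).smul (sV n)).add ((su.mul (sv n)).smul sgφ)
    · exact ((hφ.integrableOn_smul hu.1).norm.mul_const C').add
        ((hφ.integrableOn_smul_gradient hu.1).norm.const_mul C)
    · intro n
      refine Eventually.of_forall fun x => ?_
      refine (norm_add_le _ _).trans (add_le_add ?_ ?_)
      · rw [norm_smul, ← smul_eq_mul (φ x)]
        exact mul_le_mul_of_nonneg_left (norm_mollify_le _ hC' x) (norm_nonneg _)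
      · rw [mul_comm (u x), mul_smul, norm_smul]
        exact mul_le_mul_of_nonneg_right (norm_mollify_le _ hC x) (norm_nonneg _)
    · filter_upwards [aeω hlim, aeω hLim, ae_restrict_mem hω.measurableSet] with x h1 h2 hx
      simp only [Set.indicator_of_mem hx] at h1 h2 ⊢
      exact (h2.const_smul _).add ((h1.const_mul _).smul_const _)
  have hR : Tendsto (fun n => - ∫ x in ω, (φ x * mollify (ρ n) (ω.indicator v) x) • U x) atTop
      (𝓝 (- ∫ x in ω, (φ x * v x) • U x)) := by
    refine (tendsto_integral_of_dominated_convergence (fun x => C * ‖φ x • U x‖) ?_ ?_ ?_ ?_).neg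
    · intro n
      exact (sφ.mul (sv n)).smul sU
    · exact (hφ.integrableOn_smul hu.2.1).norm.const_mul C
    · intro n
      refine Eventually.of_forall fun x => ?_
      rw [mul_comm (φ x), mul_smul, norm_smul]
      exact mul_le_mul_of_nonneg_right (norm_mollify_le _ hC x) (norm_nonneg _)
    · filter_upwards [aeω hlim, ae_restrict_mem hω.measurableSet] with x h1 hx
      simp only [Set.indicator_of_mem hx] at h1 ⊢
      exact (h1.const_mul _).smul_const _
  simp only [heq] at hL
  have hfin := tendsto_nhds_unique hL hR
  simp only [mul_smul] at hfin ⊢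
  have iuV := hφ.integrableOn_smul luV
  have ivU := hφ.integrableOn_smul lvU
  have iuv := hφ.integrableOn_smul_gradient luv
  simp only [mul_smul] at iuv
  rw [integral_add iuV iuv] at hfin
  simp only [smul_add]
  rw [integral_add iuV ivU, neg_add, ← hfin]
  abel


/-! ### Boundaries of Lipschitz domains and patches -/

/-- Translates of a graph by different multiples of the vertical direction are disjoint. Infinitely
many disjoint translates by a bounded set of vectors force measure zero. -/
theorem volume_graph_eq_zero {e : Rd d} (he : ‖e‖ = 1) {γ : Rd d → ℝ} (hγ : Continuous γ) :
    volume {y : Rd d | inner ℝ e y = γ (y - inner ℝ e y • e)} = 0 := by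
  have hee : inner ℝ e e = (1 : ℝ) := by rw [real_inner_self_eq_norm_sq, he, one_pow]
  have hmeas : MeasurableSet {y : Rd d | inner ℝ e y = γ (y - inner ℝ e y • e)} :=
    (isClosed_eq (by fun_prop) (hγ.comp (by fun_prop))).measurableSet
  refine Measure.addHaar_eq_zero_of_disjoint_translates volume
    (fun n : ℕ => (1 / ((n : ℝ) + 1)) • e) ?_ ?_ hmeas
  · refine isBounded_iff_forall_norm_le.mpr ⟨1, ?_⟩
    rintro _ ⟨n, rfl⟩
    simp only [norm_smul, he, mul_one]
    rw [Real.norm_of_nonneg (by positivity)]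
    exact div_le_one_of_le₀ (by simp) (by positivity)
  · intro n m hnm
    refine Set.disjoint_left.mpr ?_
    intro z hz hz'
    obtain ⟨_, rfl, g, hg, rfl⟩ := Set.mem_add.mp hz
    obtain ⟨_, rfl, g', hg', h⟩ := Set.mem_add.mp hz'
    simp only [Set.mem_ofPred_eq] at hg hg'
    apply hnm
    set s := 1 / ((n : ℝ) + 1) with hs
    set t := 1 / ((m : ℝ) + 1) with ht
    have hg'eq : g' = (s - t) • e + g := by
      rw [sub_smul, sub_add_eq_add_sub, ← h, add_sub_cancel_left]
    have h1 : inner ℝ e g' = (s - t) + inner ℝ e g := by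
      rw [hg'eq, inner_add_right, inner_smul_right, hee, mul_one]
    have h2 : g' - inner ℝ e g' • e = g - inner ℝ e g • e := by
      rw [h1, hg'eq, add_smul]; abel
    rw [h2, ← hg] at hg'
    have h3 : s = t := by linarith
    have h4 : (n : ℝ) + 1 = (m : ℝ) + 1 := by
      simpa [hs, ht] using h3
    exact_mod_cast add_right_cancel h4

/-- Near a boundary point the frontier lies on the graph: points strictly above it have a
neighbourhood free of `ω`, and points strictly below it are in the open set `ω`. -/
theorem IsLipschitzDomain.volume_frontier (h : IsLipschitzDomain ω) :
    volume (frontier ω) = 0 := by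
  refine measure_null_of_locally_null _ fun x hx => ?_
  obtain ⟨e, he, ρ, hρ, K, γ, hγ, hgr⟩ := h.graph x hx
  refine ⟨frontier ω ∩ Metric.ball x ρ,
    inter_mem self_mem_nhdsWithin (mem_nhdsWithin_of_mem_nhds (Metric.ball_mem_nhds x hρ)), ?_⟩
  refine measure_mono_null ?_ (volume_graph_eq_zero he hγ.continuous)
  rintro y ⟨hyf, hyb⟩
  refine le_antisymm ?_ ?_
  · by_contra! hlt
    have ho : IsOpen {z : Rd d | γ (z - inner ℝ e z • e) < inner ℝ e z} :=
      isOpen_lt (hγ.continuous.comp (by fun_prop)) (by fun_prop)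
    have hnb := (ho.inter Metric.isOpen_ball).mem_nhds ⟨hlt, hyb⟩
    obtain ⟨z, ⟨hz1, hz2⟩, hz3⟩ := mem_closure_iff_nhds.mp hyf.1 _ hnb
    exact absurd ((hgr z hz2).mp hz3) (not_lt.mpr (le_of_lt hz1))
  · by_contra! hlt
    have hy : y ∈ ω := (hgr y hyb).mpr hlt
    rw [h.isOpen.frontier_eq] at hyf
    exact hyf.2 hy

theorem patch_subset (U : Set (Rd d)) (ψ : Rd d → ℝ) : patch U ψ ⊆ U := Set.inter_subset_right

/-- By continuity the nonvanishing set is open, hence contained in the interior of its own closure.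
-/
theorem mem_patch {U : Set (Rd d)} (hU : IsOpen U) {ψ : Rd d → ℝ} (hψ : ContinuousOn ψ U)
    {x : Rd d} (hx : x ∈ U) (h : ψ x ≠ 0) : x ∈ patch U ψ := by
  refine ⟨?_, hx⟩
  have ho : IsOpen {x ∈ U | ψ x ≠ 0} := hψ.isOpen_inter_preimage hU isOpen_ne
  exact interior_maximal subset_closure ho ⟨hx, h⟩

theorem eq_zero_of_notMem_patch {U : Set (Rd d)} (hU : IsOpen U) {ψ : Rd d → ℝ}
    (hψ : ContinuousOn ψ U) {x : Rd d} (hx : x ∈ U) (h : x ∉ patch U ψ) : ψ x = 0 := by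
  by_contra h0
  exact h (mem_patch hU hψ hx h0)

/-- Off the closure of the patch the function is zero on an open set, so uniqueness of weak
gradients applies there. The only remaining points lie on the boundary of the patch, a null set. -/
theorem HasWeakGrad.ae_eq_zero_off_patch {U : Set (Rd d)} (hU : IsOpen U) {ψ : Rd d → ℝ}
    {G : Rd d → Rd d} (hG : HasWeakGrad U ψ G) (hψ : ContinuousOn ψ U)
    (hL : IsLipschitzDomain (patch U ψ)) :
    ∀ᵐ x ∂volume.restrict U, x ∉ patch U ψ → G x = 0 := by
  set O := U \ closure (patch U ψ)
  have hO : IsOpen O := hU.sdiff isClosed_closure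
  have h1 : HasWeakGrad O ψ G := hG.mono hU Set.sdiff_subset
  have h0 : ψ =ᵐ[volume.restrict O] fun _ => 0 := by
    filter_upwards [ae_restrict_mem hO.measurableSet] with x hx
    exact eq_zero_of_notMem_patch hU hψ hx.1 fun h => hx.2 (subset_closure h)
  have h2 := (ae_restrict_iff' hO.measurableSet).mp (h1.unique hO HasWeakGrad.zero h0)
  have h3 : ∀ᵐ x, x ∉ frontier (patch U ψ) := measure_eq_zero_iff_ae_notMem.mp hL.volume_frontier
  rw [ae_restrict_iff' hU.measurableSet]
  filter_upwards [h2, h3] with x hx hxf hxU hxp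
  refine hx ⟨hxU, fun hc => hxf ?_⟩
  rw [hL.isOpen.frontier_eq]
  exact ⟨hc, hxp⟩

/-! ### The spaces `H¹`, `W^{1,∞}` and `H₀¹` -/

theorem MemH1.hasWeakGrad {u : Rd d → ℝ} (h : MemH1 ω u) : HasWeakGrad ω u (weakGrad ω u) := by
  obtain ⟨-, G, hG, -⟩ := h
  exact hG.weakGrad

theorem MemH1.memLp_weakGrad (hω : IsOpen ω) {u : Rd d → ℝ} (h : MemH1 ω u) :
    MemLp (weakGrad ω u) 2 (volume.restrict ω) := by
  obtain ⟨-, G, hG, hL⟩ := h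
  exact hL.ae_eq (hG.ae_eq hω).symm

theorem MemW1inf.hasWeakGrad {u : Rd d → ℝ} (h : MemW1inf ω u) :
    HasWeakGrad ω u (weakGrad ω u) := by
  obtain ⟨-, G, hG, -⟩ := h
  exact hG.weakGrad

theorem MemW1inf.memLp_weakGrad (hω : IsOpen ω) {u : Rd d → ℝ} (h : MemW1inf ω u) :
    MemLp (weakGrad ω u) ⊤ (volume.restrict ω) := by
  obtain ⟨-, G, hG, hL⟩ := h
  exact hL.ae_eq (hG.ae_eq hω).symm

theorem IsTestFun.memLp {φ : Rd d → ℝ} (h : IsTestFun ω φ) (μ : Measure (Rd d))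
    [IsFiniteMeasureOnCompacts μ] : MemLp φ 2 μ :=
  h.1.continuous.memLp_of_hasCompactSupport h.2.1

theorem IsTestFun.memLp_gradient {φ : Rd d → ℝ} (h : IsTestFun ω φ) (μ : Measure (Rd d))
    [IsFiniteMeasureOnCompacts μ] : MemLp (gradient φ) 2 μ :=
  (continuous_gradient h.1).memLp_of_hasCompactSupport
    (HasCompactSupport.of_support_subset_isCompact h.2.1 fun x hx => by
      by_contra hx'
      exact hx (gradient_eq_zero_of_notMem_tsupport hx'))

theorem IsTestFun.memH1 {φ : Rd d → ℝ} (h : IsTestFun ω' φ) : MemH1 ω φ :=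
  ⟨h.memLp _, gradient φ, HasWeakGrad.of_contDiff h.1, h.memLp_gradient _⟩

theorem gradient_const_mul {φ : Rd d → ℝ} {x : Rd d} (hφ : DifferentiableAt ℝ φ x) (c : ℝ) :
    gradient (fun y => c * φ y) x = c • gradient φ x := by
  rw [gradient_mul (differentiableAt_const c) hφ]
  simp [gradient_fun_const']

theorem gradient_add {φ g : Rd d → ℝ} {x : Rd d} (hφ : DifferentiableAt ℝ φ x)
    (hg : DifferentiableAt ℝ g x) :
    gradient (fun y => φ y + g y) x = gradient φ x + gradient g x := by
  refine ext_inner_right ℝ fun e => ?_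
  rw [inner_add_left, inner_gradient_left, inner_gradient_left, inner_gradient_left,
    fderiv_fun_add hφ hg]
  simp

theorem MemH1.add {u v : Rd d → ℝ} (hu : MemH1 ω u) (hv : MemH1 ω v) :
    MemH1 ω fun x => u x + v x := by
  obtain ⟨hu, G, hG, hL⟩ := hu
  obtain ⟨hv, H, hH, hM⟩ := hv
  exact ⟨hu.add hv, _, hG.add hH, hL.add hM⟩

theorem MemH1.const_mul {u : Rd d → ℝ} (hu : MemH1 ω u) (c : ℝ) :
    MemH1 ω fun x => c * u x := by
  obtain ⟨hu, G, hG, hL⟩ := hu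
  exact ⟨hu.const_mul c, _, hG.const_mul c, hL.const_smul c⟩

theorem tendsto_normL2_add {E : Type*} [NormedAddCommGroup E] {f g : ℕ → Rd d → E} {f' g' : Rd d → E}
    (hf : Tendsto (fun n => normL2 ω (fun x => f n x - f' x)) atTop (𝓝 0))
    (hg : Tendsto (fun n => normL2 ω (fun x => g n x - g' x)) atTop (𝓝 0))
    (mf : ∀ n, AEStronglyMeasurable (fun x => f n x - f' x) (volume.restrict ω))
    (mg : ∀ n, AEStronglyMeasurable (fun x => g n x - g' x) (volume.restrict ω)) :
    Tendsto (fun n => normL2 ω (fun x => (f n x + g n x) - (f' x + g' x))) atTop (𝓝 0) := by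
  have h := hf.add hg
  rw [add_zero] at h
  refine tendsto_of_tendsto_of_tendsto_of_le_of_le tendsto_const_nhds h (fun _ => zero_le)
    fun n => ?_
  refine le_trans (le_of_eq ?_) (eLpNorm_add_le (mf n) (mg n) one_le_two)
  refine eLpNorm_congr_ae (Eventually.of_forall fun x => ?_)
  simp only [Pi.add_apply]
  abel

theorem tendsto_normL2_const_smul {E : Type*} [NormedAddCommGroup E] [NormedSpace ℝ E]
    {f : ℕ → Rd d → E} {f' : Rd d → E}
    (hf : Tendsto (fun n => normL2 ω (fun x => f n x - f' x)) atTop (𝓝 0)) (c : ℝ) :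
    Tendsto (fun n => normL2 ω (fun x => c • f n x - c • f' x)) atTop (𝓝 0) := by
  have h := ENNReal.Tendsto.const_mul (a := ‖c‖ₑ) hf (Or.inr (by simp))
  rw [mul_zero] at h
  refine h.congr fun n => ?_
  rw [normL2, normL2, ← eLpNorm_const_smul]
  refine eLpNorm_congr_ae (Eventually.of_forall fun x => ?_)
  simp [smul_sub]

theorem tendsto_normL2_congr {E : Type*} [NormedAddCommGroup E] {f g : ℕ → Rd d → E}
    {f' g' : Rd d → E}
    (hf : Tendsto (fun n => normL2 ω (fun x => f n x - f' x)) atTop (𝓝 0))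
    (h : ∀ n, f n =ᵐ[volume.restrict ω] g n) (h' : f' =ᵐ[volume.restrict ω] g') :
    Tendsto (fun n => normL2 ω (fun x => g n x - g' x)) atTop (𝓝 0) := by
  refine hf.congr fun n => eLpNorm_congr_ae ?_
  filter_upwards [h n, h'] with x h1 h2
  rw [h1, h2]

/-- Approximating sequences are added. As `weakGrad` is an arbitrary representative, it is additive
only almost everywhere, which suffices for the norms. -/
theorem MemH10.add (hω : IsOpen ω) {u v : Rd d → ℝ} (hu : MemH10 ω u) (hv : MemH10 ω v) :
    MemH10 ω fun x => u x + v x := by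
  obtain ⟨hu, φ, hφ, h1, h2⟩ := hu
  obtain ⟨hv, χ, hχ, h3, h4⟩ := hv
  refine ⟨hu.add hv, fun n x => φ n x + χ n x, fun n => ⟨(hφ n).1.add (hχ n).1,
    (hφ n).2.1.add (hχ n).2.1, (tsupport_add _ _).trans
      (Set.union_subset (hφ n).2.2 (hχ n).2.2)⟩, ?_, ?_⟩
  · exact tendsto_normL2_add h1 h3 (fun n => (((hφ n).memLp _).sub hu.1).aestronglyMeasurable)
      (fun n => (((hχ n).memLp _).sub hv.1).aestronglyMeasurable)
  · refine tendsto_normL2_congr (tendsto_normL2_add h2 h4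
      (fun n => (((hφ n).memLp_gradient _).sub (hu.memLp_weakGrad hω)).aestronglyMeasurable)
      (fun n => (((hχ n).memLp_gradient _).sub (hv.memLp_weakGrad hω)).aestronglyMeasurable)) ?_
      ((hu.hasWeakGrad.add hv.hasWeakGrad).ae_eq hω).symm
    intro n
    refine Eventually.of_forall fun x => ?_
    exact (gradient_add ((hφ n).1.differentiable (by simp) x)
      ((hχ n).1.differentiable (by simp) x)).symm

theorem MemH10.const_mul (hω : IsOpen ω) {u : Rd d → ℝ} (hu : MemH10 ω u) (c : ℝ) :
    MemH10 ω fun x => c * u x := by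
  obtain ⟨hu, φ, hφ, h1, h2⟩ := hu
  refine ⟨hu.const_mul c, fun n x => c * φ n x, fun n => ⟨contDiff_const.mul (hφ n).1,
    (hφ n).2.1.mul_left, tsupport_mul_subset_right.trans (hφ n).2.2⟩, ?_, ?_⟩
  · exact tendsto_normL2_const_smul h1 c
  · refine tendsto_normL2_congr (tendsto_normL2_const_smul h2 c) ?_
      ((hu.hasWeakGrad.const_mul c).ae_eq hω).symm
    intro n
    refine Eventually.of_forall fun x => ?_
    exact (gradient_const_mul ((hφ n).1.differentiable (by simp) x) c).symm

theorem MemH10.sub (hω : IsOpen ω) {u v : Rd d → ℝ} (hu : MemH10 ω u) (hv : MemH10 ω v) :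
    MemH10 ω fun x => u x - v x := by
  have := hu.add hω (hv.const_mul hω (-1))
  simpa [sub_eq_add_neg] using this

/-! ### Weak divergences -/

theorem inner_toLp {E : Type*} [NormedAddCommGroup E] [InnerProductSpace ℝ E]
    {μ : Measure (Rd d)} {w g : Rd d → E} (hw : MemLp w 2 μ) (hg : MemLp g 2 μ) :
    inner ℝ (hw.toLp w) (hg.toLp g) = ∫ x, inner ℝ (w x) (g x) ∂μ := by
  rw [L2.inner_def]
  refine integral_congr_ae ?_
  filter_upwards [hw.coeFn_toLp, hg.coeFn_toLp] with x e1 e2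
  rw [e1, e2]

theorem tendsto_integral_inner {E : Type*} [NormedAddCommGroup E] [InnerProductSpace ℝ E]
    {μ : Measure (Rd d)} {w h : Rd d → E} {k : ℕ → Rd d → E} (hw : MemLp w 2 μ)
    (hh : MemLp h 2 μ) (hk : ∀ n, MemLp (k n) 2 μ)
    (hlim : Tendsto (fun n => eLpNorm (fun x => k n x - h x) 2 μ) atTop (𝓝 0)) :
    Tendsto (fun n => ∫ x, inner ℝ (w x) (k n x) ∂μ) atTop (𝓝 (∫ x, inner ℝ (w x) (h x) ∂μ)) := by
  have h1 : Tendsto (fun n => (hk n).toLp (k n)) atTop (𝓝 (hh.toLp h)) :=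
    (Lp.tendsto_Lp_iff_tendsto_eLpNorm'' k hk h hh).mpr hlim
  have h2 : Tendsto (fun n => inner ℝ (hw.toLp w) ((hk n).toLp (k n))) atTop
      (𝓝 (inner ℝ (hw.toLp w) (hh.toLp h))) := tendsto_const_nhds.inner h1
  simpa only [inner_toLp] using h2

/-- The Green formula for functions of `H₀¹`. -/
theorem HasWeakDiv.integral_inner_weakGrad (hω : IsOpen ω) {w : Rd d → Rd d} {g : Rd d → ℝ}
    (h : HasWeakDiv ω w g) (hw : MemLp w 2 (volume.restrict ω))
    (hg : MemLp g 2 (volume.restrict ω)) {v : Rd d → ℝ} (hv : MemH10 ω v) :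
    ∫ x in ω, inner ℝ (w x) (weakGrad ω v x) = - ∫ x in ω, g x * v x := by
  obtain ⟨hv, φ, hφ, h1, h2⟩ := hv
  have t1 := tendsto_integral_inner hw (hv.memLp_weakGrad hω)
    (fun n => (hφ n).memLp_gradient _) h2
  have t2 := tendsto_integral_inner hg hv.1 (fun n => (hφ n).memLp _) h1
  have e : ∀ n, ∫ x in ω, inner ℝ (w x) (gradient (φ n) x)
      = - ∫ x in ω, inner ℝ (g x) (φ n x) := fun n => by
    rw [h.2.2 _ (hφ n)]
    simp [mul_comm]
  simp only [e] at t1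
  have := tendsto_nhds_unique t1 t2.neg
  rw [this]
  simp [mul_comm]

theorem HasWeakDiv.unique (hω : IsOpen ω) {w : Rd d → Rd d} {g g' : Rd d → ℝ}
    (h : HasWeakDiv ω w g) (h' : HasWeakDiv ω w g') : g =ᵐ[volume.restrict ω] g' := by
  refine ae_eq_of_forall_testFun hω h.2.1 h'.2.1 fun φ hφ => ?_
  have := (h.2.2 φ hφ).symm.trans (h'.2.2 φ hφ)
  simpa [mul_comm] using this

theorem HasWeakDiv.add {w w' : Rd d → Rd d} {g g' : Rd d → ℝ}
    (h : HasWeakDiv ω w g) (h' : HasWeakDiv ω w' g') :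
    HasWeakDiv ω (fun x => w x + w' x) (fun x => g x + g' x) := by
  refine ⟨h.1.add h'.1, h.2.1.add h'.2.1, fun φ hφ => ?_⟩
  simp only [inner_add_left, add_mul]
  have i1 := hφ.integrableOn_smul h.2.1
  have i2 := hφ.integrableOn_smul h'.2.1
  simp only [smul_eq_mul, mul_comm (φ _)] at i1 i2
  rw [integral_add (hφ.integrableOn_inner_gradient h.1) (hφ.integrableOn_inner_gradient h'.1),
    integral_add i1 i2, h.2.2 φ hφ, h'.2.2 φ hφ, neg_add]

theorem HasWeakDiv.zero : HasWeakDiv ω (fun _ => 0) (fun _ => 0) :=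
  ⟨locallyIntegrableOn_zero, locallyIntegrableOn_zero, fun φ _ => by simp⟩

theorem HasWeakDiv.sum {ι : Type*} (s : Finset ι) {w : ι → Rd d → Rd d} {g : ι → Rd d → ℝ}
    (h : ∀ i, HasWeakDiv ω (w i) (g i)) :
    HasWeakDiv ω (fun x => ∑ i ∈ s, w i x) (fun x => ∑ i ∈ s, g i x) := by
  classical
  induction s using Finset.induction_on with
  | empty => simpa using HasWeakDiv.zero
  | insert i s hi ih => simpa [Finset.sum_insert hi] using (h i).add ih

theorem HasWeakDiv.congr {w : Rd d → Rd d} {g g' : Rd d → ℝ}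
    (h : HasWeakDiv ω w g) (hg : g =ᵐ[volume.restrict ω] g') : HasWeakDiv ω w g' := by
  refine ⟨h.1, LocallyIntegrableOn.congr_ae h.2.1 hg, fun φ hφ => ?_⟩
  rw [h.2.2 φ hφ]
  congr 1
  exact integral_congr_ae (by filter_upwards [hg] with x hx; rw [hx])

theorem IsTestFun.tendstoH1 (hω : IsOpen ω) {φ : Rd d → ℝ} (h : IsTestFun ω' φ) :
    TendstoH1 ω (fun _ => φ) φ := by
  have h0 : (fun x => gradient φ x - weakGrad ω φ x) =ᵐ[volume.restrict ω] 0 := by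
    filter_upwards [(HasWeakGrad.of_contDiff (ω := ω) h.1).ae_eq hω] with x hx
    simp [hx]
  constructor
  · simp [normL2]
  · simp [normL2, eLpNorm_congr_ae h0]

/-- The constant sequence already approximates `φ`, so no trace theorem is involved: its boundary
values vanish pointwise on `Γ`. -/
theorem IsTestFun.traceZeroOn (hω : IsOpen ω) {φ : Rd d → ℝ} (h : IsTestFun ω' φ)
    {Γ : Set (Rd d)} (hΓ : ∀ x ∈ Γ, x ∉ ω') : TraceZeroOn ω φ Γ := by
  refine ⟨fun _ => φ, fun _ => h.1, h.tendstoH1 hω, ?_⟩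
  have h0 : φ =ᵐ[(Measure.hausdorffMeasure ((d : ℝ) - 1)).restrict Γ] fun _ => 0 := by
    rw [EventuallyEq, ae_restrict_iff
      (isClosed_eq h.1.continuous continuous_const).measurableSet]
    exact Eventually.of_forall fun x hx => h.eq_zero (hΓ x hx)
  simp [eLpNorm_congr_ae h0]

/-- The extension by zero of a function of `H₀(div, ω)` has a weak divergence in `Ω`. -/
theorem MemHdiv0.hasWeakDiv_indicator {Ω : Set (Rd d)} (hΩ : IsOpen Ω) (hω : IsOpen ω) (hs : ω ⊆ Ω)
    {ψ : Rd d → ℝ} {w : Rd d → Rd d} {p : Rd d → ℝ} (hw : MemHdiv0 Ω ω ψ w)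
    (hp : HasWeakDiv ω w p) (hψ : ∀ x ∈ frontier ω, ψ x ≠ 0 → x ∉ Ω) :
    HasWeakDiv Ω (ω.indicator w) (ω.indicator p) := by
  obtain ⟨hw2, g, hg2, hg, h1, h2⟩ := hw
  -- The normal trace condition is stated for some weak divergence `g`; uniqueness identifies it
  -- with the prescribed `p`.
  have hpg := hp.unique hω hg
  have hp2 : MemLp p 2 (volume.restrict ω) := hg2.ae_eq hpg.symm
  refine ⟨locallyIntegrableOn_of_memLp one_le_two
    (((memLp_indicator_iff_restrict hω.measurableSet).mpr hw2).restrict Ω),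
    locallyIntegrableOn_of_memLp one_le_two
    (((memLp_indicator_iff_restrict hω.measurableSet).mpr hp2).restrict Ω), fun φ hφ => ?_⟩
  have key : (∫ x in ω, inner ℝ (w x) (weakGrad ω φ x)) + ∫ x in ω, g x * φ x = 0 := by
    by_cases hc : MemH10 Ω ψ
    -- The normal trace vanishes on the entire boundary here, so the trace of `φ` need only vanish
    -- on the empty set.
    · exact h1 hc φ hφ.memH1 (hφ.traceZeroOn hω fun x hx => absurd hx.1 hx.2)
    -- Where the normal trace is unconstrained, `ψ` is nonzero; by `hψ` such boundary points lie
    -- outside `Ω`, where `φ` vanishes.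
    · refine h2 hc φ hφ.memH1 (hφ.traceZeroOn hω fun x hx => hψ x hx.1 fun h0 => ?_)
      exact hx.2 ⟨hx.1, h0⟩
  have e1 : ∫ x in ω, inner ℝ (w x) (weakGrad ω φ x) = ∫ x in ω, inner ℝ (w x) (gradient φ x) := by
    refine integral_congr_ae ?_
    filter_upwards [(HasWeakGrad.of_contDiff (ω := ω) hφ.1).ae_eq hω] with x hx
    rw [hx]
  have e2 : ∫ x in ω, g x * φ x = ∫ x in ω, p x * φ x :=
    integral_congr_ae (by filter_upwards [hpg] with x hx; rw [hx])
  rw [e1, e2, ← eq_neg_iff_add_eq_zero] at key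
  rw [← setIntegral_eq_of_subset_of_zero (ω' := ω) hΩ.measurableSet hs,
    ← setIntegral_eq_of_subset_of_zero (ω' := ω) hΩ.measurableSet hs]
  · refine Eq.trans (setIntegral_congr_fun hω.measurableSet fun x hx => ?_)
      (key.trans (congrArg Neg.neg (setIntegral_congr_fun hω.measurableSet fun x hx => ?_)))
    · simp only [Set.indicator_of_mem hx]
    · simp only [Set.indicator_of_mem hx]
  · intro x hx
    simp [Set.indicator_of_notMem hx]
  · intro x hx
    rw [Set.indicator_of_notMem hx, inner_zero_left]


/-! ### The Jacobian weight and the Petrov-Galerkin projection -/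

section

variable {𝒱 : Type*} {𝒲 : 𝒱 → Type*} {D : Geometry d 𝒱 𝒲} {S : Spaces D}

/-- The Jacobian determinant of the parametrization as a function on the physical domain. -/
def Geometry.weight (D : Geometry d 𝒱 𝒲) (x : Rd d) : ℝ := D.detDF (D.Finv x)

theorem Geometry.Finv_mem {x : Rd d} (hx : x ∈ D.Ω) : D.Finv x ∈ D.Ωhat :=
  Function.invFunOn_mem hx

theorem Geometry.F_Finv {x : Rd d} (hx : x ∈ D.Ω) : D.F (D.Finv x) = x :=
  Function.invFunOn_eq hx

theorem Geometry.piolaInv_Finv (q : Rd d → ℝ) {x : Rd d} (hx : x ∈ D.Ω) :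
    D.piolaInv q (D.Finv x) = D.weight x * q x := by
  rw [Geometry.piolaInv, Geometry.F_Finv hx, Geometry.weight]

/-- The `d`-dimensional Hausdorff measure is a Haar measure, so it has the same null sets as the
volume, and a Lipschitz map increases it at most by a constant factor. -/
theorem LipschitzOnWith.volume_image_eq_zero {K : NNReal} {f : Rd d → Rd d} {s : Set (Rd d)}
    (h : LipschitzOnWith K f s) (hs : volume s = 0) : volume (f '' s) = 0 := by
  have hr : (Module.finrank ℝ (Rd d) : ℝ) = d := by simp
  have hH : (Measure.hausdorffMeasure (d : ℝ) : Measure (Rd d)).IsAddHaarMeasure := by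
    have := isAddHaarMeasure_hausdorffMeasure (E := Rd d)
    rwa [hr] at this
  have h1 : Measure.hausdorffMeasure (d : ℝ) s = 0 :=
    Measure.absolutelyContinuous_isAddHaarMeasure _ volume hs
  have h2 : Measure.hausdorffMeasure (d : ℝ) (f '' s) = 0 := by
    have := h.hausdorffMeasure_image_le (d := (d : ℝ)) (by positivity)
    rwa [h1, mul_zero, nonpos_iff_eq_zero] at this
  exact Measure.absolutelyContinuous_isAddHaarMeasure volume _ h2

/-- Positivity holds off a null set of the parameter domain, and `F` maps that set to a null set of
`Ω`. -/
theorem GeneralSetting.weight_pos (h : GeneralSetting S) :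
    ∀ᵐ x ∂volume.restrict D.Ω, 0 < D.weight x := by
  obtain ⟨K, hK⟩ := h.lipschitz
  have hd := (ae_restrict_iff' h.lipschitz_dom.isOpen.measurableSet).mp h.det_pos
  have h0 : volume {y | ¬ (y ∈ D.Ωhat → 0 < D.detDF y)} = 0 := ae_iff.mp hd
  have h1 : volume (D.F '' {y | ¬ (y ∈ D.Ωhat → 0 < D.detDF y)}) = 0 :=
    LipschitzOnWith.volume_image_eq_zero (hK.mono fun y hy => (Classical.not_imp.mp hy).1) h0
  rw [ae_restrict_iff' h.isOpen.measurableSet]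
  filter_upwards [measure_eq_zero_iff_ae_notMem.mp h1] with x hx hxΩ
  by_contra hw
  exact hx ⟨D.Finv x, fun hc => hw (hc (Geometry.Finv_mem hxΩ)), Geometry.F_Finv hxΩ⟩

theorem GeneralSetting.continuousOn_Finv (h : GeneralSetting S) : ContinuousOn D.Finv D.Ω := by
  obtain ⟨K, hK⟩ := h.lipschitz_inv
  refine LipschitzOnWith.continuousOn (K := K) (LipschitzOnWith.of_dist_le_mul ?_)
  intro x hx y hy
  have := hK _ (Geometry.Finv_mem hx) _ (Geometry.Finv_mem hy)
  rwa [Geometry.F_Finv hx, Geometry.F_Finv hy] at this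

/-- The Lipschitz constant of `F` bounds `DF`, and the determinant is bounded on a closed ball of
linear maps by compactness. Measurability uses the continuity of `F⁻¹` on `Ω`. -/
theorem GeneralSetting.memLp_weight (h : GeneralSetting S) :
    MemLp D.weight ⊤ (volume.restrict D.Ω) := by
  obtain ⟨K, hK⟩ := h.lipschitz
  obtain ⟨C, hC⟩ := (isCompact_closedBall (0 : Rd d →L[ℝ] Rd d) K).exists_bound_of_continuousOn
    (ContinuousLinearMap.continuous_det (𝕜 := ℝ) (E := Rd d)).continuousOn
  have hm : Measurable D.detDF :=
    ContinuousLinearMap.continuous_det.measurable.comp (measurable_fderiv ℝ D.F)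
  have hF : AEMeasurable D.Finv (volume.restrict D.Ω) :=
    h.continuousOn_Finv.aemeasurable h.isOpen.measurableSet
  refine memLp_top_of_bound (hm.comp_aemeasurable hF).aestronglyMeasurable C ?_
  filter_upwards [ae_restrict_mem h.isOpen.measurableSet] with x hx
  refine hC _ ?_
  rw [mem_closedBall_zero_iff]
  exact norm_fderiv_le_of_lipschitzOn ℝ
    (h.lipschitz_dom.isOpen.mem_nhds (Geometry.Finv_mem hx)) hK

/-- This is why the Piola transforms of constants lead to plain mean values when used as trial
functions for the test space. -/
theorem GeneralSetting.weight_mul_piola (h : GeneralSetting S) (c : ℝ) :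
    ∀ᵐ x ∂volume.restrict D.Ω, D.weight x * D.piola (fun _ => c) x = c := by
  filter_upwards [h.weight_pos] with x hx
  exact mul_inv_cancel_left₀ hx.ne' c

/-- Two Petrov-Galerkin projections of the same function onto a space on `Ω` agree. -/
theorem IsPGProjection.unique (h : GeneralSetting S) {Q : Submodule ℝ (L2 D.Ω)} {g : Rd d → ℝ}
    {p p' : L2 D.Ω} (hp : IsPGProjection D Q g p) (hp' : IsPGProjection D Q g p') : p = p' := by
  set z : L2 D.Ω := p - p'
  have hz : z ∈ Q := Q.sub_mem hp.1 hp'.1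
  have hw : MemLp (fun x => D.weight x * z x) 2 (volume.restrict D.Ω) :=
    (Lp.memLp z).mul h.memLp_weight
  have hW : (fun x => D.piolaInv z (D.Finv x)) =ᵐ[volume.restrict D.Ω]
      fun x => D.weight x * z x := by
    filter_upwards [ae_restrict_mem h.isOpen.measurableSet] with x hx
    exact Geometry.piolaInv_Finv _ hx
  have hi : ∀ y : L2 D.Ω, Integrable (fun x => y x * (D.weight x * z x))
      (volume.restrict D.Ω) := fun y => (Lp.memLp y).integrable_mul hw
  have e : ∀ y : L2 D.Ω, ∫ x in D.Ω, y x * D.piolaInv z (D.Finv x)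
      = ∫ x in D.Ω, y x * (D.weight x * z x) := fun y =>
    integral_congr_ae (by filter_upwards [hW] with x hx; rw [hx])
  have h1 : ∫ x in D.Ω, p x * (D.weight x * z x) = ∫ x in D.Ω, p' x * (D.weight x * z x) := by
    rw [← e, ← e, hp.2 z hz, hp'.2 z hz]
  have hzc : (z : Rd d → ℝ) =ᵐ[volume.restrict D.Ω] fun x => p x - p' x := Lp.coeFn_sub p p'
  -- Testing with the difference `z` itself gives a weighted integral of `z ^ 2`; positivity of the
  -- weight then forces `z = 0`.
  have h2 : ∫ x in D.Ω, z x * (D.weight x * z x) = 0 := by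
    rw [← sub_eq_zero, ← integral_sub (hi p) (hi p')] at h1
    rw [← h1]
    refine integral_congr_ae ?_
    filter_upwards [hzc] with x hx
    rw [← sub_mul, ← hx]
  have h3 := (integral_eq_zero_iff_of_nonneg_ae (by
    filter_upwards [h.weight_pos] with x hx
    have := mul_nonneg hx.le (mul_self_nonneg (z x))
    simp only [Pi.zero_apply]
    linarith) (hi z)).mp h2
  refine sub_eq_zero.mp (Lp.ext ?_)
  filter_upwards [h3, h.weight_pos, Lp.coeFn_zero ℝ 2 (volume.restrict D.Ω)] with x hx hpos h0
  have hx0 : z x = 0 := by simpa [hpos.ne'] using hx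
  rw [h0]
  exact hx0

end

/-! ### The abstract error bound -/

theorem abs_integral_inner_le {E : Type*} [NormedAddCommGroup E] [InnerProductSpace ℝ E]
    {μ : Measure (Rd d)} {w g : Rd d → E} (hw : MemLp w 2 μ) (hg : MemLp g 2 μ) :
    |∫ x, inner ℝ (w x) (g x) ∂μ| ≤ (eLpNorm w 2 μ).toReal * (eLpNorm g 2 μ).toReal := by
  rw [← inner_toLp hw hg, ← Lp.norm_toLp w hw, ← Lp.norm_toLp g hg]
  exact abs_real_inner_le_norm _ _

theorem integral_inner_self {E : Type*} [NormedAddCommGroup E] [InnerProductSpace ℝ E]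
    {μ : Measure (Rd d)} {w : Rd d → E} (hw : MemLp w 2 μ) :
    ∫ x, inner ℝ (w x) (w x) ∂μ = (eLpNorm w 2 μ).toReal ^ 2 := by
  rw [← inner_toLp hw hw, ← Lp.norm_toLp w hw, real_inner_self_eq_norm_sq]

theorem integrable_inner_of_memLp {E : Type*} [NormedAddCommGroup E] [InnerProductSpace ℝ E]
    {μ : Measure (Rd d)} {w g : Rd d → E} (hw : MemLp w 2 μ) (hg : MemLp g 2 μ) :
    Integrable (fun x => inner ℝ (w x) (g x)) μ := by
  refine (L2.integrable_inner (𝕜 := ℝ) (hw.toLp w) (hg.toLp g)).congr ?_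
  filter_upwards [hw.coeFn_toLp, hg.coeFn_toLp] with x e1 e2
  rw [e1, e2]

/-- The error bound for a flux whose divergence is close to the right-hand side. -/
theorem IsWeakSolution.error_le {Ω : Set (Rd d)} (hΩ : IsOpen Ω) {f u uh divσ : L2 Ω}
    {σ : Rd d → Rd d} (hu : IsWeakSolution Ω f u) (huh : MemH10 Ω uh)
    (hσ : MemLp σ 2 (volume.restrict Ω)) (hdiv : HasWeakDiv Ω σ divσ) :
    normL2 Ω (weakGrad Ω (fun x => u x - uh x)) ≤
      normL2 Ω (fun x => σ x + weakGrad Ω uh x) + normHneg1 Ω (fun x => f x - divσ x) := by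
  have he : MemH10 Ω (fun x => u x - uh x) := hu.1.sub hΩ huh
  set G := weakGrad Ω (fun x => u x - uh x) with hGdef
  have hG : MemLp G 2 (volume.restrict Ω) := he.1.memLp_weakGrad hΩ
  have hU := hu.1.1.memLp_weakGrad hΩ
  have hUh := huh.1.memLp_weakGrad hΩ
  have hGeq : G =ᵐ[volume.restrict Ω] fun x => weakGrad Ω u x - weakGrad Ω uh x :=
    (hu.1.1.hasWeakGrad.sub huh.1.hasWeakGrad).ae_eq hΩ
  -- A vanishing error is treated apart, since the error is normalized below.
  by_cases h0 : normL2 Ω G = 0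
  · rw [h0]; exact zero_le
  have htop : normL2 Ω G ≠ ⊤ := hG.2.ne
  set n := (normL2 Ω G).toReal with hn
  have hnpos : 0 < n := ENNReal.toReal_pos h0 htop
  set v : Rd d → ℝ := fun x => n⁻¹ * (u x - uh x) with hv
  have hv10 : MemH10 Ω v := he.const_mul hΩ n⁻¹
  have hVeq : weakGrad Ω v =ᵐ[volume.restrict Ω] fun x => n⁻¹ • G x :=
    (he.1.hasWeakGrad.const_mul n⁻¹).ae_eq hΩ
  have hV : MemLp (weakGrad Ω v) 2 (volume.restrict Ω) := hv10.1.memLp_weakGrad hΩ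
  have hVnorm : normL2 Ω (weakGrad Ω v) = 1 := by
    rw [normL2, eLpNorm_congr_ae hVeq]
    have : eLpNorm (fun x => n⁻¹ • G x) 2 (volume.restrict Ω) = ‖n⁻¹‖ₑ * normL2 Ω G :=
      eLpNorm_const_smul n⁻¹ G 2 _
    rw [this, Real.enorm_of_nonneg (inv_nonneg.mpr hnpos.le), ← ENNReal.ofReal_toReal htop, ← hn,
      ← ENNReal.ofReal_mul (inv_nonneg.mpr hnpos.le), inv_mul_cancel₀ hnpos.ne',
      ENNReal.ofReal_one]
  have hsum : MemLp (fun x => σ x + weakGrad Ω uh x) 2 (volume.restrict Ω) := hσ.add hUh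
  have e1 : ∫ x in Ω, inner ℝ (G x) (weakGrad Ω v x) = n := by
    have : ∫ x in Ω, inner ℝ (G x) (weakGrad Ω v x) = ∫ x in Ω, n⁻¹ * inner ℝ (G x) (G x) := by
      refine integral_congr_ae ?_
      filter_upwards [hVeq] with x hx
      rw [hx, inner_smul_right]
    rw [this, integral_const_mul, integral_inner_self hG]
    change n⁻¹ * n ^ 2 = n
    field_simp
  have e2 : ∫ x in Ω, inner ℝ (G x) (weakGrad Ω v x)
      = (∫ x in Ω, f x * v x) - ∫ x in Ω, inner ℝ (weakGrad Ω uh x) (weakGrad Ω v x) := by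
    rw [← hu.2 v hv10, ← integral_sub (integrable_inner_of_memLp hU hV)
      (integrable_inner_of_memLp hUh hV)]
    refine integral_congr_ae ?_
    filter_upwards [hGeq] with x hx
    rw [hx, inner_sub_left]
  have e3 := hdiv.integral_inner_weakGrad hΩ hσ (Lp.memLp divσ) hv10
  have e4 : ∫ x in Ω, inner ℝ (σ x + weakGrad Ω uh x) (weakGrad Ω v x)
      = (∫ x in Ω, inner ℝ (σ x) (weakGrad Ω v x))
        + ∫ x in Ω, inner ℝ (weakGrad Ω uh x) (weakGrad Ω v x) := by
    rw [← integral_add (integrable_inner_of_memLp hσ hV) (integrable_inner_of_memLp hUh hV)]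
    simp only [inner_add_left]
  have e5 : ∫ x in Ω, (f x - divσ x) * v x
      = (∫ x in Ω, f x * v x) - ∫ x in Ω, divσ x * v x := by
    have i1 : Integrable (fun x => f x * v x) (volume.restrict Ω) :=
      (Lp.memLp f).integrable_mul hv10.1.1
    have i2 : Integrable (fun x => divσ x * v x) (volume.restrict Ω) :=
      (Lp.memLp divσ).integrable_mul hv10.1.1
    rw [← integral_sub i1 i2]
    simp only [sub_mul]
  -- The flux is added and subtracted: the Green formula trades `⟨σ, ∇v⟩` for `-⟨div σ, v⟩`.
  have e6 : n = - (∫ x in Ω, inner ℝ (σ x + weakGrad Ω uh x) (weakGrad Ω v x))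
      + ∫ x in Ω, (f x - divσ x) * v x := by
    rw [e4, e5, e3, ← e1, e2]; ring
  have h1 := abs_integral_inner_le hsum hV
  change _ ≤ _ * (normL2 Ω (weakGrad Ω v)).toReal at h1
  rw [hVnorm, ENNReal.toReal_one, mul_one] at h1
  calc normL2 Ω G = ENNReal.ofReal n := (ENNReal.ofReal_toReal htop).symm
    _ ≤ ENNReal.ofReal (- (∫ x in Ω, inner ℝ (σ x + weakGrad Ω uh x) (weakGrad Ω v x)))
        + ENNReal.ofReal (∫ x in Ω, (f x - divσ x) * v x) := by
      rw [e6]; exact ENNReal.ofReal_add_le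
    _ ≤ _ := by
      refine add_le_add ?_ ?_
      · refine ENNReal.ofReal_le_of_le_toReal ((neg_le_abs _).trans h1)
      · exact le_iSup_of_le v (le_iSup_of_le hv10 (le_iSup_of_le hVnorm le_rfl))


/-! ### Local identities on the patches -/

theorem memLp_inner_top {μ : Measure (Rd d)} {G H : Rd d → Rd d} (hG : MemLp G 2 μ)
    (hH : MemLp H ⊤ μ) : MemLp (fun x => inner ℝ (G x) (H x)) 2 μ := by
  obtain ⟨C, hC⟩ := exists_ae_bound_of_memLp_top hH
  refine MemLp.of_le_mul (c := C) hG (hG.aestronglyMeasurable.inner hH.aestronglyMeasurable) ?_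
  filter_upwards [hC] with x hx
  rw [mul_comm]
  exact (norm_inner_le_norm _ _).trans (mul_le_mul_of_nonneg_left hx (norm_nonneg _))

section

variable {𝒱 : Type*} {𝒲 : 𝒱 → Type*} {D : Geometry d 𝒱 𝒲} {S : Spaces D}

theorem Geometry.large_subset (D : Geometry d 𝒱 𝒲) (a : 𝒱) : D.large a ⊆ D.Ω := patch_subset _ _

theorem Geometry.small_subset_large (D : Geometry d 𝒱 𝒲) (a : 𝒱) (b : 𝒲 a) :
    D.small a b ⊆ D.large a := patch_subset _ _

theorem Geometry.small_subset (D : Geometry d 𝒱 𝒲) (a : 𝒱) (b : 𝒲 a) : D.small a b ⊆ D.Ω :=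
  (D.small_subset_large a b).trans (D.large_subset a)

theorem Geometry.prod_eq {a : 𝒱} {b : 𝒲 a} {x : Rd d} (hx : x ∈ D.large a) :
    D.prod a b x = D.ψ a x * D.φ a b x := by
  rw [Geometry.prod, Set.indicator_of_mem (subset_closure hx)]

/-- The local datum, written with weak gradients on the large patch. -/
def largeDatum (D : Geometry d 𝒱 𝒲) (f uh : L2 D.Ω) (a : 𝒱) (r : L2 (D.large a)) (b : 𝒲 a) :
    Rd d → ℝ :=
  fun x => f x * (D.ψ a x * D.φ a b x)
    - inner ℝ (weakGrad D.Ω uh x) (D.ψ a x • weakGrad (D.large a) (D.φ a b) x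
        + D.φ a b x • weakGrad D.Ω (D.ψ a) x)
    - inner ℝ (weakGrad (D.large a) r x) (weakGrad (D.large a) (D.φ a b) x)

theorem NodePartition.continuousOn [Fintype 𝒱]
    (hn : NodePartition S) (a : 𝒱) : ContinuousOn (D.ψ a) D.Ω :=
  (hn.cont a).mono subset_closure

theorem VertexPartition.continuousOn [∀ a, Fintype (𝒲 a)]
    (hv : VertexPartition S) (a : 𝒱) (b : 𝒲 a) :
    ContinuousOn (D.φ a b) (D.large a) :=
  (hv.cont a b).mono subset_closure

theorem NodePartition.hasWeakGrad_large [Fintype 𝒱]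
    (hs : GeneralSetting S) (hn : NodePartition S) (a : 𝒱) :
    HasWeakGrad (D.large a) (D.ψ a) (weakGrad D.Ω (D.ψ a)) :=
  (hn.mem a).hasWeakGrad.mono hs.isOpen (D.large_subset a)

theorem MemLp.restrict_mono {E : Type*} [NormedAddCommGroup E] {p : ENNReal} {g : Rd d → E}
    (h : MemLp g p (volume.restrict ω)) (hs : ω' ⊆ ω) : MemLp g p (volume.restrict ω') :=
  h.mono_measure (Measure.restrict_mono_set _ hs)

theorem ae_restrict_mono {p : Rd d → Prop} (h : ∀ᵐ x ∂volume.restrict ω, p x) (hs : ω' ⊆ ω) :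
    ∀ᵐ x ∂volume.restrict ω', p x :=
  ae_mono (Measure.restrict_mono_set _ hs) h

theorem hasWeakGrad_prod_large [Fintype 𝒱] [∀ a, Fintype (𝒲 a)]
    (hs : GeneralSetting S) (hn : NodePartition S)
    (hv : VertexPartition S) (a : 𝒱) (b : 𝒲 a) :
    HasWeakGrad (D.large a) (fun x => D.ψ a x * D.φ a b x)
      (fun x => D.ψ a x • weakGrad (D.large a) (D.φ a b) x
        + D.φ a b x • weakGrad D.Ω (D.ψ a) x) :=
  (hn.hasWeakGrad_large hs a).mul (hn.patch_lipschitz a).isOpen (hv.mem a b).hasWeakGrad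
    (MemLp.restrict_mono (hn.mem a).1 (D.large_subset a))
    (MemLp.restrict_mono ((hn.mem a).memLp_weakGrad hs.isOpen) (D.large_subset a))
    (hv.mem a b).1 ((hv.mem a b).memLp_weakGrad (hn.patch_lipschitz a).isOpen)

theorem memLp_grad_prod_large [Fintype 𝒱] [∀ a, Fintype (𝒲 a)]
    (hs : GeneralSetting S) (hn : NodePartition S)
    (hv : VertexPartition S) (a : 𝒱) (b : 𝒲 a) :
    MemLp (fun x => D.ψ a x • weakGrad (D.large a) (D.φ a b) x
        + D.φ a b x • weakGrad D.Ω (D.ψ a) x) ⊤ (volume.restrict (D.large a)) := by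
  have h1 : MemLp (fun x => D.ψ a x • weakGrad (D.large a) (D.φ a b) x) ⊤
      (volume.restrict (D.large a)) :=
    ((hv.mem a b).memLp_weakGrad (hn.patch_lipschitz a).isOpen).smul
      (MemLp.restrict_mono (hn.mem a).1 (D.large_subset a))
  have h2 : MemLp (fun x => D.φ a b x • weakGrad D.Ω (D.ψ a) x) ⊤
      (volume.restrict (D.large a)) :=
    (MemLp.restrict_mono ((hn.mem a).memLp_weakGrad hs.isOpen) (D.large_subset a)).smul
      (hv.mem a b).1
  exact h1.add h2

/-- The datum involves the weak gradient of the product on the small patch. Uniqueness replaces it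
by the product rule formula inherited from the large patch. -/
theorem localDatum_ae_eq [Fintype 𝒱] [∀ a, Fintype (𝒲 a)]
    (hs : GeneralSetting S) (hn : NodePartition S)
    (hv : VertexPartition S) (f uh : L2 D.Ω) (a : 𝒱) (r : L2 (D.large a)) (b : 𝒲 a) :
    localDatum D f uh a r b =ᵐ[volume.restrict (D.small a b)] largeDatum D f uh a r b := by
  have ho := (hv.patch_lipschitz a b).isOpen
  have hprod : ∀ᵐ x ∂volume.restrict (D.small a b), D.ψ a x * D.φ a b x = D.prod a b x := by
    filter_upwards [ae_restrict_mem ho.measurableSet] with x hx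
    exact (Geometry.prod_eq (D.small_subset_large a b hx)).symm
  have h1 := (((hasWeakGrad_prod_large hs hn hv a b).mono (hn.patch_lipschitz a).isOpen
    (D.small_subset_large a b)).congr hprod EventuallyEq.rfl).ae_eq ho
  filter_upwards [h1, hprod] with x h1 h2
  rw [localDatum, largeDatum, h1, h2]

/-- Every term of `largeDatum` contains `ψ_b` or its gradient, and both vanish almost everywhere off
the small patch. Data of different small patches can thus be summed on the common large patch. -/
theorem indicator_localDatum_ae_eq [Fintype 𝒱] [∀ a, Fintype (𝒲 a)]
    (hs : GeneralSetting S) (hn : NodePartition S)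
    (hv : VertexPartition S) (f uh : L2 D.Ω) (a : 𝒱) (r : L2 (D.large a)) (b : 𝒲 a) :
    (D.small a b).indicator (localDatum D f uh a r b)
      =ᵐ[volume.restrict (D.large a)] largeDatum D f uh a r b := by
  have ho := (hn.patch_lipschitz a).isOpen
  have h1 := (ae_restrict_iff' (hv.patch_lipschitz a b).isOpen.measurableSet).mp
    (localDatum_ae_eq hs hn hv f uh a r b)
  have h2 := (hv.mem a b).hasWeakGrad.ae_eq_zero_off_patch ho (hv.continuousOn a b)
    (hv.patch_lipschitz a b)
  filter_upwards [ae_restrict_of_ae h1, h2, ae_restrict_mem ho.measurableSet] with x h1 h2 hx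
  by_cases hxs : x ∈ D.small a b
  · rw [Set.indicator_of_mem hxs, h1 hxs]
  · rw [Set.indicator_of_notMem hxs, largeDatum, h2 hxs,
      eq_zero_of_notMem_patch ho (hv.continuousOn a b) hx hxs]
    simp

theorem sum_weakGrad_vertex [Fintype 𝒱] [∀ a, Fintype (𝒲 a)]
    (hn : NodePartition S) (hv : VertexPartition S) (a : 𝒱) :
    ∀ᵐ x ∂volume.restrict (D.large a), ∑ b, weakGrad (D.large a) (D.φ a b) x = 0 := by
  have ho := (hn.patch_lipschitz a).isOpen
  refine (HasWeakGrad.sum Finset.univ fun b => (hv.mem a b).hasWeakGrad).unique ho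
    (HasWeakGrad.const 1) ?_
  filter_upwards [ae_restrict_mem ho.measurableSet] with x hx
  exact hv.sum_eq_one a x hx

theorem sum_weakGrad_node [Fintype 𝒱] (hs : GeneralSetting S) (hn : NodePartition S) :
    ∀ᵐ x ∂volume.restrict D.Ω, ∑ a, weakGrad D.Ω (D.ψ a) x = 0 := by
  refine (HasWeakGrad.sum Finset.univ fun a => (hn.mem a).hasWeakGrad).unique hs.isOpen
    (HasWeakGrad.const 1) ?_
  filter_upwards [ae_restrict_mem hs.isOpen.measurableSet] with x hx
  exact hn.sum_eq_one x hx

/-- On the large patch the `ψ_b` sum to one and their gradients to zero, which eliminates the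
residual lifting. Elsewhere in `Ω` both sides vanish almost everywhere. -/
theorem sum_vertex_localDatum [Fintype 𝒱] [∀ a, Fintype (𝒲 a)]
    (hs : GeneralSetting S) (hn : NodePartition S)
    (hv : VertexPartition S) (f uh : L2 D.Ω) (a : 𝒱) (r : L2 (D.large a)) :
    ∀ᵐ x ∂volume.restrict D.Ω, ∑ b, (D.small a b).indicator (localDatum D f uh a r b) x
      = f x * D.ψ a x - inner ℝ (weakGrad D.Ω uh x) (weakGrad D.Ω (D.ψ a) x) := by
  have ho := (hn.patch_lipschitz a).isOpen
  have h1 : ∀ᵐ x ∂volume.restrict (D.large a), ∀ b,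
      (D.small a b).indicator (localDatum D f uh a r b) x = largeDatum D f uh a r b x :=
    ae_all_iff.mpr fun b => indicator_localDatum_ae_eq hs hn hv f uh a r b
  have h1' := (ae_restrict_iff' ho.measurableSet).mp h1
  have h2 := (ae_restrict_iff' ho.measurableSet).mp (sum_weakGrad_vertex hn hv a)
  have h3 := (hn.mem a).hasWeakGrad.ae_eq_zero_off_patch hs.isOpen (hn.continuousOn a)
    (hn.patch_lipschitz a)
  filter_upwards [ae_restrict_of_ae h1', ae_restrict_of_ae h2, h3,
    ae_restrict_mem hs.isOpen.measurableSet] with x h1 h2 h3 hx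
  by_cases hxl : x ∈ D.large a
  · rw [Finset.sum_congr rfl fun b _ => h1 hxl b]
    simp only [largeDatum]
    rw [Finset.sum_sub_distrib, Finset.sum_sub_distrib, ← inner_sum, ← inner_sum, h2 hxl,
      ← Finset.mul_sum, ← Finset.mul_sum, Finset.sum_add_distrib, ← Finset.smul_sum,
      ← Finset.sum_smul, h2 hxl, hv.sum_eq_one a x hxl]
    simp
  · rw [h3 hxl, eq_zero_of_notMem_patch hs.isOpen (hn.continuousOn a) hx hxl]
    rw [Finset.sum_eq_zero fun b _ =>
      Set.indicator_of_notMem (fun h => hxl (D.small_subset_large a b h)) _]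
    simp

theorem sum_localDatum [Fintype 𝒱] [∀ a, Fintype (𝒲 a)]
    (hs : GeneralSetting S) (hn : NodePartition S)
    (hv : VertexPartition S) (f uh : L2 D.Ω) (r : (a : 𝒱) → L2 (D.large a)) :
    ∀ᵐ x ∂volume.restrict D.Ω,
      ∑ a, ∑ b, (D.small a b).indicator (localDatum D f uh a (r a) b) x = f x := by
  filter_upwards [ae_all_iff.mpr fun a => sum_vertex_localDatum hs hn hv f uh a (r a),
    sum_weakGrad_node hs hn, ae_restrict_mem hs.isOpen.measurableSet] with x h1 h2 hx
  rw [Finset.sum_congr rfl fun a _ => h1 a, Finset.sum_sub_distrib, ← inner_sum, h2,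
    ← Finset.mul_sum, hn.sum_eq_one x hx]
  simp

/-! ### Mean values of the local data and testing of their projections -/

variable {f uh : L2 D.Ω}

theorem memLp_largeDatum [Fintype 𝒱] [∀ a, Fintype (𝒲 a)]
    (hs : GeneralSetting S) (hn : NodePartition S)
    (hv : VertexPartition S) (huh : MemH10 D.Ω uh) {a : 𝒱} {r : L2 (D.large a)}
    (hr : MemH1 (D.large a) r) (b : 𝒲 a) :
    MemLp (fun x => f x * (D.ψ a x * D.φ a b x)) 2 (volume.restrict (D.large a)) ∧
    MemLp (fun x => inner ℝ (weakGrad D.Ω uh x)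
      (D.ψ a x • weakGrad (D.large a) (D.φ a b) x + D.φ a b x • weakGrad D.Ω (D.ψ a) x)) 2
      (volume.restrict (D.large a)) ∧
    MemLp (fun x => inner ℝ (weakGrad (D.large a) r x) (weakGrad (D.large a) (D.φ a b) x)) 2
      (volume.restrict (D.large a)) := by
  have ho := (hn.patch_lipschitz a).isOpen
  have hψφ : MemLp (fun x => D.ψ a x * D.φ a b x) ⊤ (volume.restrict (D.large a)) :=
    (hv.mem a b).1.mul (MemLp.restrict_mono (hn.mem a).1 (D.large_subset a))
  refine ⟨hψφ.mul (MemLp.restrict_mono (Lp.memLp f) (D.large_subset a)),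
    memLp_inner_top (MemLp.restrict_mono (huh.1.memLp_weakGrad hs.isOpen) (D.large_subset a))
      (memLp_grad_prod_large hs hn hv a b),
    memLp_inner_top (hr.memLp_weakGrad ho) ((hv.mem a b).memLp_weakGrad ho)⟩

theorem memLp_localDatum [Fintype 𝒱] [∀ a, Fintype (𝒲 a)]
    (hs : GeneralSetting S) (hn : NodePartition S)
    (hv : VertexPartition S) (huh : MemH10 D.Ω uh) {a : 𝒱} {r : L2 (D.large a)}
    (hr : MemH1 (D.large a) r) (b : 𝒲 a) :
    MemLp (localDatum D f uh a r b) 2 (volume.restrict (D.small a b)) := by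
  obtain ⟨h1, h2, h3⟩ := memLp_largeDatum (f := f) hs hn hv huh hr b
  exact (MemLp.restrict_mono ((h1.sub h2).sub h3) (D.small_subset_large a b)).ae_eq
    (localDatum_ae_eq hs hn hv f uh a r b).symm

theorem IsLipschitzDomain.isFiniteMeasure (h : IsLipschitzDomain ω) :
    IsFiniteMeasure (volume.restrict ω) :=
  ⟨by simpa using h.isBounded.measure_lt_top⟩

/-- The residual of the partition of unity function of a node, restricted to its patch. -/
theorem setIntegral_node_residual [Fintype 𝒱] (hs : GeneralSetting S) (hn : NodePartition S)
    (huh : IsGalerkinSolution S f uh) {a : 𝒱} (ha : MemH10 D.Ω (D.ψ a)) :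
    (∫ x in D.large a, f x * D.ψ a x)
      - ∫ x in D.large a, inner ℝ (weakGrad D.Ω uh x) (weakGrad D.Ω (D.ψ a) x) = 0 := by
  -- For an interior node, `ψ_a` is a discrete function, so the Galerkin equation applies. Shrinking
  -- `Ω` to the patch loses nothing, because `ψ_a` and its gradient vanish off it.
  obtain ⟨v, hvV, hveq⟩ := hn.mem_Vh a ha
  have hmem := hs.Vh_sub v hvV
  have hgr : weakGrad D.Ω v =ᵐ[volume.restrict D.Ω] weakGrad D.Ω (D.ψ a) :=
    hmem.1.hasWeakGrad.unique hs.isOpen (hn.mem a).hasWeakGrad hveq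
  have h0 := huh.2 v hvV
  have hoff := (hn.mem a).hasWeakGrad.ae_eq_zero_off_patch hs.isOpen (hn.continuousOn a)
    (hn.patch_lipschitz a)
  have e1 : ∫ x in D.Ω, f x * v x = ∫ x in D.large a, f x * D.ψ a x := by
    refine Eq.trans (b := ∫ x in D.Ω, f x * D.ψ a x) ?_
      (setIntegral_eq_of_subset_of_ae_sdiff_eq_zero hs.isOpen.measurableSet.nullMeasurableSet
        (D.large_subset a) ?_)
    · exact integral_congr_ae (by filter_upwards [hveq] with x hx; rw [hx])
    · refine Eventually.of_forall fun x hx => ?_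
      rw [eq_zero_of_notMem_patch hs.isOpen (hn.continuousOn a) hx.1 hx.2, mul_zero]
  have e2 : ∫ x in D.Ω, inner ℝ (weakGrad D.Ω uh x) (weakGrad D.Ω v x)
      = ∫ x in D.large a, inner ℝ (weakGrad D.Ω uh x) (weakGrad D.Ω (D.ψ a) x) := by
    refine Eq.trans (b := ∫ x in D.Ω, inner ℝ (weakGrad D.Ω uh x) (weakGrad D.Ω (D.ψ a) x)) ?_
      (setIntegral_eq_of_subset_of_ae_sdiff_eq_zero hs.isOpen.measurableSet.nullMeasurableSet
        (D.large_subset a) ?_)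
    · exact integral_congr_ae (by filter_upwards [hgr] with x hx; rw [hx])
    · filter_upwards [(ae_restrict_iff' hs.isOpen.measurableSet).mp hoff] with x hx hxd
      rw [hx hxd.1 hxd.2, inner_zero_right]
  rw [← e1, ← e2, h0, sub_self]

/-- If the vertex function is a discrete function up to the constant `c`, the integral of the local
datum is `c` times the residual of the node function. -/
theorem setIntegral_largeDatum [Fintype 𝒱] [∀ a, Fintype (𝒲 a)]
    (hs : GeneralSetting S) (hn : NodePartition S)
    (hv : VertexPartition S) (huh : MemH10 D.Ω uh) {a : 𝒱} {r : L2 (D.large a)}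
    (hr : IsResidualLifting S f uh a r) (b : 𝒲 a) {v : L2 (D.large a)} (hvV : v ∈ S.Vloc a) {c : ℝ}
    (hvc : D.φ a b =ᵐ[volume.restrict (D.large a)] fun x => v x + c) :
    ∫ x in D.large a, largeDatum D f uh a r b x =
      c * ((∫ x in D.large a, f x * D.ψ a x)
        - ∫ x in D.large a, inner ℝ (weakGrad D.Ω uh x) (weakGrad D.Ω (D.ψ a) x)) := by
  have ho := (hn.patch_lipschitz a).isOpen
  have hfin := (hn.patch_lipschitz a).isFiniteMeasure
  have hr1 : MemH1 (D.large a) r := (hv.Vloc_sub a r hr.1).1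
  have hv1 : MemH1 (D.large a) v := (hv.Vloc_sub a v hvV).1
  obtain ⟨m1, m2, m3⟩ := memLp_largeDatum (f := f) hs hn hv huh hr1 b
  have mψ : MemLp (D.ψ a) ⊤ (volume.restrict (D.large a)) :=
    MemLp.restrict_mono (hn.mem a).1 (D.large_subset a)
  have mΨ : MemLp (weakGrad D.Ω (D.ψ a)) ⊤ (volume.restrict (D.large a)) :=
    MemLp.restrict_mono ((hn.mem a).memLp_weakGrad hs.isOpen) (D.large_subset a)
  have mf : MemLp (fun x => f x * D.ψ a x) 2 (volume.restrict (D.large a)) :=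
    mψ.mul (MemLp.restrict_mono (Lp.memLp f) (D.large_subset a))
  have mu : MemLp (fun x => inner ℝ (weakGrad D.Ω uh x) (weakGrad D.Ω (D.ψ a) x)) 2
      (volume.restrict (D.large a)) := memLp_inner_top
    (MemLp.restrict_mono (huh.1.memLp_weakGrad hs.isOpen) (D.large_subset a)) mΨ
  have i1 := m1.integrable one_le_two
  have i2 := m2.integrable one_le_two
  have i3 := m3.integrable one_le_two
  have jf := mf.integrable one_le_two
  have ju := mu.integrable one_le_two
  have hveq : ∀ᵐ x ∂volume.restrict (D.large a), v x = D.φ a b x - c := by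
    filter_upwards [hvc] with x hx
    rw [hx]; ring
  have g1 : weakGrad (D.large a) v =ᵐ[volume.restrict (D.large a)]
      weakGrad (D.large a) (D.φ a b) := by
    have := hv1.hasWeakGrad.unique ho ((hv.mem a b).hasWeakGrad.sub (HasWeakGrad.const c)) hveq
    simpa using this
  -- Writing `v ψ_a = ψ_a ψ_b - c ψ_a` avoids a product rule for `v`, which is only known to lie in
  -- `H¹`.
  have g2 : weakGrad (D.large a) (fun y => v y * D.ψ a y) =ᵐ[volume.restrict (D.large a)]
      fun x => (D.ψ a x • weakGrad (D.large a) (D.φ a b) x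
        + D.φ a b x • weakGrad D.Ω (D.ψ a) x) - c • weakGrad D.Ω (D.ψ a) x := by
    have h1 := (hasWeakGrad_prod_large hs hn hv a b).sub ((hn.hasWeakGrad_large hs a).const_mul c)
    refine (h1.congr ?_ EventuallyEq.rfl).ae_eq ho
    filter_upwards [hveq] with x hx
    rw [hx]; ring
  -- The residual equation with `v = ψ_b - c` cancels every term of the datum except those carrying
  -- the factor `c`.
  have hres := hr.2 v hvV
  have r1 : ∫ x in D.large a, inner ℝ (weakGrad (D.large a) r x) (weakGrad (D.large a) v x)
      = ∫ x in D.large a,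
        inner ℝ (weakGrad (D.large a) r x) (weakGrad (D.large a) (D.φ a b) x) :=
    integral_congr_ae (by filter_upwards [g1] with x hx; rw [hx])
  have r2 : ∫ x in D.large a, f x * (v x * D.ψ a x)
      = (∫ x in D.large a, f x * (D.ψ a x * D.φ a b x)) - c * ∫ x in D.large a, f x * D.ψ a x := by
    rw [← integral_const_mul, ← integral_sub i1 (jf.const_mul c)]
    refine integral_congr_ae ?_
    filter_upwards [hveq] with x hx
    rw [hx]; ring
  have r3 : ∫ x in D.large a, inner ℝ (weakGrad D.Ω uh x)
        (weakGrad (D.large a) (fun y => v y * D.ψ a y) x)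
      = (∫ x in D.large a, inner ℝ (weakGrad D.Ω uh x)
        (D.ψ a x • weakGrad (D.large a) (D.φ a b) x + D.φ a b x • weakGrad D.Ω (D.ψ a) x))
        - c * ∫ x in D.large a, inner ℝ (weakGrad D.Ω uh x) (weakGrad D.Ω (D.ψ a) x) := by
    rw [← integral_const_mul, ← integral_sub i2 (ju.const_mul c)]
    refine integral_congr_ae ?_
    filter_upwards [g2] with x hx
    rw [hx, inner_sub_right, inner_smul_right]
  have hsplit : ∫ x in D.large a, largeDatum D f uh a r b x
      = (∫ x in D.large a, f x * (D.ψ a x * D.φ a b x))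
        - (∫ x in D.large a, inner ℝ (weakGrad D.Ω uh x)
        (D.ψ a x • weakGrad (D.large a) (D.φ a b) x + D.φ a b x • weakGrad D.Ω (D.ψ a) x))
        - ∫ x in D.large a,
          inner ℝ (weakGrad (D.large a) r x) (weakGrad (D.large a) (D.φ a b) x) := by
    rw [← integral_sub i1 i2]
    exact integral_sub (i1.sub i2) i3
  rw [r1, r2, r3] at hres
  rw [hsplit, hres]
  ring

/-- The local datum of an interior patch has vanishing mean. -/
theorem setIntegral_localDatum_eq_zero [Fintype 𝒱] [∀ a, Fintype (𝒲 a)]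
    (hs : GeneralSetting S) (hn : NodePartition S)
    (hv : VertexPartition S) (huh : IsGalerkinSolution S f uh) {a : 𝒱} {r : L2 (D.large a)}
    (hr : IsResidualLifting S f uh a r) {b : 𝒲 a} (hab : MemH10 D.Ω (D.prod a b)) :
    ∫ x in D.small a b, localDatum D f uh a r b x = 0 := by
  have hm := (hv.patch_lipschitz a b).isOpen.measurableSet
  have h1 : ∫ x in D.small a b, localDatum D f uh a r b x
      = ∫ x in D.large a, largeDatum D f uh a r b x := by
    rw [← integral_congr_ae (indicator_localDatum_ae_eq hs hn hv f uh a r b),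
      setIntegral_indicator hm, Set.inter_eq_self_of_subset_right (D.small_subset_large a b)]
  rw [h1]
  have huh10 := hs.Vh_sub uh huh.1
  by_cases ha : MemH10 D.Ω (D.ψ a)
  · obtain ⟨v, hvV, c, hvc⟩ := hv.mem_Vloc_interior a b hab ha
    rw [setIntegral_largeDatum hs hn hv huh10 hr b hvV hvc,
      setIntegral_node_residual hs hn huh ha, mul_zero]
  · obtain ⟨v, hvV, hvc⟩ := hv.mem_Vloc_boundary a b hab ha
    -- At a boundary node `ψ_b` itself is discrete, so `c = 0` and no Galerkin equation for `ψ_a` is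
    -- required.
    rw [setIntegral_largeDatum (c := 0) hs hn hv huh10 hr b hvV (by simpa using hvc), zero_mul]

/-- Testing the projection of the local datum with functions of the global space. -/
theorem IsPGProjection.setIntegral_eq [Fintype 𝒱] [∀ a, Fintype (𝒲 a)]
    (hs : GeneralSetting S) (hn : NodePartition S)
    (hv : VertexPartition S) (he : EquilibrationSpaces S) (huh : IsGalerkinSolution S f uh)
    {a : 𝒱} {r : L2 (D.large a)} (hr : IsResidualLifting S f uh a r) {b : 𝒲 a}
    {p : L2 (D.small a b)} (hp : IsPGProjection D (S.Q a b) (localDatum D f uh a r b) p)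
    {q : L2 D.Ω} (hq : q ∈ S.Qh) :
    ∫ x in D.small a b, p x * (D.weight x * q x)
      = ∫ x in D.small a b, localDatum D f uh a r b x * (D.weight x * q x) := by
  have ho := (hv.patch_lipschitz a b).isOpen
  have hfin := (hv.patch_lipschitz a b).isFiniteMeasure
  have hsub := D.small_subset a b
  have hr1 : MemH1 (D.large a) r := (hv.Vloc_sub a r hr.1).1
  have md := memLp_localDatum (f := f) hs hn hv (hs.Vh_sub uh huh.1) hr1 b
  have hw : ∀ q' : L2 (D.small a b), MemLp (fun x => D.weight x * q' x) 2
      (volume.restrict (D.small a b)) := fun q' =>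
    (Lp.memLp q').mul (MemLp.restrict_mono hs.memLp_weight hsub)
  have htest : ∀ q' ∈ S.Q a b, ∫ x in D.small a b, p x * (D.weight x * q' x)
      = ∫ x in D.small a b, localDatum D f uh a r b x * (D.weight x * q' x) := by
    intro q' hq'
    have h := hp.2 q' hq'
    have hpi : ∀ᵐ x ∂volume.restrict (D.small a b),
        D.piolaInv q' (D.Finv x) = D.weight x * q' x := by
      filter_upwards [ae_restrict_mem ho.measurableSet] with x hx
      exact Geometry.piolaInv_Finv _ (hsub hx)
    refine (integral_congr_ae ?_).trans (h.trans (integral_congr_ae ?_)) <;>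
    · filter_upwards [hpi] with x hx
      rw [hx]
  by_cases hab : MemH10 D.Ω (D.prod a b)
  · obtain ⟨q', hq', c, hqc⟩ := he.Qh_interior q hq a b hab
    -- The weight cancels the Jacobian factor in the Piola transform, leaving the constant `c`,
    -- which sees only mean values.
    have hwq : ∀ᵐ x ∂volume.restrict (D.small a b),
        D.weight x * q x = D.weight x * q' x + c := by
      filter_upwards [hqc, ae_restrict_mono (hs.weight_mul_piola c) hsub] with x h1 h2
      rw [h1, mul_add, h2]
    have hsplit : ∀ g : Rd d → ℝ, MemLp g 2 (volume.restrict (D.small a b)) →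
        ∫ x in D.small a b, g x * (D.weight x * q x)
          = (∫ x in D.small a b, g x * (D.weight x * q' x)) + (∫ x in D.small a b, g x) * c := by
      intro g hg
      have i1 : Integrable (fun x => g x * (D.weight x * q' x))
          (volume.restrict (D.small a b)) := hg.integrable_mul (hw q')
      rw [← integral_mul_const, ← integral_add i1 ((hg.integrable one_le_two).mul_const c)]
      refine integral_congr_ae ?_
      filter_upwards [hwq] with x hx
      rw [hx, mul_add]
    rw [hsplit p (Lp.memLp p), hsplit _ md, htest q' hq', (he.Q_sub a b p hp.1).2 hab,
      setIntegral_localDatum_eq_zero hs hn hv huh hr hab]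
  · obtain ⟨q', hq', hqq⟩ := he.Qh_boundary q hq a b hab
    refine (integral_congr_ae ?_).trans ((htest q' hq').trans (integral_congr_ae ?_)) <;>
    · filter_upwards [hqq] with x hx
      rw [hx]

/-! ### Gluing the local fluxes and the global residual -/

/-- The boundary of a small patch meets the domain only where the partition functions vanish. -/
theorem notMem_of_mem_frontier_small [Fintype 𝒱] [∀ a, Fintype (𝒲 a)]
    (hs : GeneralSetting S) (hn : NodePartition S)
    (hv : VertexPartition S) (a : 𝒱) (b : 𝒲 a) {x : Rd d} (hx : x ∈ frontier (D.small a b))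
    (h0 : D.prod a b x ≠ 0) : x ∉ D.Ω := by
  intro hxΩ
  -- Inside `Ω`, nonvanishing of both factors places `x` in the large and then in the small patch;
  -- the latter is open and so misses its frontier.
  have h1 : D.ψ a x ≠ 0 := left_ne_zero_of_mul h0
  have hl : x ∈ D.large a := mem_patch hs.isOpen (hn.continuousOn a) hxΩ h1
  rw [Geometry.prod_eq hl] at h0
  have hsm : x ∈ D.small a b :=
    mem_patch (hn.patch_lipschitz a).isOpen (hv.continuousOn a b) hl (right_ne_zero_of_mul h0)
  rw [(hv.patch_lipschitz a b).isOpen.frontier_eq] at hx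
  exact hx.2 hsm

theorem EquilibrationSpaces.hasWeakDiv_indicator [Fintype 𝒱] [∀ a, Fintype (𝒲 a)]
    (hs : GeneralSetting S) (hn : NodePartition S)
    (hv : VertexPartition S) (he : EquilibrationSpaces S) {a : 𝒱} {b : 𝒲 a}
    {σ : L2Vec (D.small a b)} (hσ : σ ∈ S.V a b) {p : L2 (D.small a b)}
    (hp : HasWeakDiv (D.small a b) σ p) :
    HasWeakDiv D.Ω ((D.small a b).indicator σ) ((D.small a b).indicator p) :=
  (he.V_sub a b σ hσ).hasWeakDiv_indicator hs.isOpen (hv.patch_lipschitz a b).isOpen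
    (D.small_subset a b) hp fun _ hx => notMem_of_mem_frontier_small hs hn hv a b hx

theorem memLp_indicator_small [∀ a, Fintype (𝒲 a)]
    {E : Type*} [NormedAddCommGroup E] (hv : VertexPartition S) {a : 𝒱}
    {b : 𝒲 a} {g : Rd d → E} (hg : MemLp g 2 (volume.restrict (D.small a b))) :
    MemLp ((D.small a b).indicator g) 2 (volume.restrict D.Ω) :=
  ((memLp_indicator_iff_restrict (hv.patch_lipschitz a b).isOpen.measurableSet).mpr hg).restrict _

/-- The residual of the equilibrated flux is orthogonal to the test functions. -/
theorem setIntegral_residual_eq_zero [Fintype 𝒱] [∀ a, Fintype (𝒲 a)]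
    (hs : GeneralSetting S) (hn : NodePartition S)
    (hv : VertexPartition S) (he : EquilibrationSpaces S) (huh : IsGalerkinSolution S f uh)
    {r : (a : 𝒱) → L2 (D.large a)} (hr : ∀ a, IsResidualLifting S f uh a (r a))
    {p : (a : 𝒱) → (b : 𝒲 a) → L2 (D.small a b)}
    (hp : ∀ a b, IsPGProjection D (S.Q a b) (localDatum D f uh a (r a) b) (p a b))
    {divσ : L2 D.Ω} (hdiv : divσ =ᵐ[volume.restrict D.Ω]
      fun x => ∑ a, ∑ b, (D.small a b).indicator (p a b) x)
    {q : L2 D.Ω} (hq : q ∈ S.Qh) :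
    ∫ x in D.Ω, (f x - divσ x) * D.piolaInv q (D.Finv x) = 0 := by
  have hwq : MemLp (fun x => D.weight x * q x) 2 (volume.restrict D.Ω) :=
    (Lp.memLp q).mul hs.memLp_weight
  have hd : ∀ a b, MemLp ((D.small a b).indicator (localDatum D f uh a (r a) b)) 2
      (volume.restrict D.Ω) := fun a b => memLp_indicator_small hv
    (memLp_localDatum hs hn hv (hs.Vh_sub uh huh.1) (hv.Vloc_sub a _ (hr a).1).1 b)
  have hpm : ∀ a b, MemLp ((D.small a b).indicator (p a b)) 2 (volume.restrict D.Ω) :=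
    fun a b => memLp_indicator_small hv (Lp.memLp _)
  have hm : ∀ a b, MeasurableSet (D.small a b) := fun a b =>
    (hv.patch_lipschitz a b).isOpen.measurableSet
  have hterm : ∀ a b, ∫ x in D.Ω, ((D.small a b).indicator (localDatum D f uh a (r a) b) x
      - (D.small a b).indicator (p a b) x) * (D.weight x * q x) = 0 := by
    intro a b
    have hind : ∀ g : Rd d → ℝ, ∫ x in D.Ω, (D.small a b).indicator g x * (D.weight x * q x)
        = ∫ x in D.small a b, g x * (D.weight x * q x) := by
      intro g
      rw [← Set.inter_eq_self_of_subset_right (D.small_subset a b), ← setIntegral_indicator (hm a b),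
        Set.inter_eq_self_of_subset_right (D.small_subset a b)]
      refine integral_congr_ae (Eventually.of_forall fun x => ?_)
      simp only [Set.indicator_mul_left]
    have i1 : Integrable (fun x => (D.small a b).indicator (localDatum D f uh a (r a) b) x
      * (D.weight x * q x)) (volume.restrict D.Ω) := (hd a b).integrable_mul hwq
    have i2 : Integrable (fun x => (D.small a b).indicator (p a b) x
      * (D.weight x * q x)) (volume.restrict D.Ω) := (hpm a b).integrable_mul hwq
    simp only [sub_mul]
    rw [integral_sub i1 i2, hind, hind,
      (hp a b).setIntegral_eq hs hn hv he huh (hr a) hq, sub_self]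
  have hsum : ∫ x in D.Ω, (f x - divσ x) * D.piolaInv q (D.Finv x)
      = ∫ x in D.Ω, ∑ a, ∑ b, ((D.small a b).indicator (localDatum D f uh a (r a) b) x
      - (D.small a b).indicator (p a b) x) * (D.weight x * q x) := by
    refine integral_congr_ae ?_
    -- Replacing `f` by the sum of all local data localizes the residual to differences of a datum
    -- and its projection.
    filter_upwards [sum_localDatum hs hn hv f uh r, hdiv,
      ae_restrict_mem hs.isOpen.measurableSet] with x h1 h2 hx
    rw [Geometry.piolaInv_Finv _ hx, ← h1, h2]
    simp only [← Finset.sum_mul, Finset.sum_sub_distrib]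
  have hi : ∀ a b, Integrable (fun x => ((D.small a b).indicator (localDatum D f uh a (r a) b) x
      - (D.small a b).indicator (p a b) x) * (D.weight x * q x)) (volume.restrict D.Ω) :=
    fun a b => ((hd a b).sub (hpm a b)).integrable_mul hwq
  rw [hsum, integral_finsetSum _ fun a _ => integrable_finsetSum _ fun b _ => hi a b]
  refine Finset.sum_eq_zero fun a _ => ?_
  rw [integral_finsetSum _ fun b _ => hi a b]
  exact Finset.sum_eq_zero fun b _ => hterm a b

end

end EquilibratedFlux

end

/-! ### The main theorem -/

open EquilibratedFlux
/-- The flux lies in `H(div, Ω)`, the projection of `f - div σ_h` into `Qh` is well defined, and the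
guaranteed upper bound on the error holds. -/
theorem proposition8p1 {d : ℕ} (hd : d = 2 ∨ d = 3)
    {𝒱 : Type*} [Fintype 𝒱] {𝒲 : 𝒱 → Type*} [∀ a, Fintype (𝒲 a)]
    (D : Geometry d 𝒱 𝒲) (S : Spaces D)
    (hsetting : GeneralSetting S) (hnodes : NodePartition S)
    (hvertices : VertexPartition S) (hspaces : EquilibrationSpaces S)
    (f u uh : L2 D.Ω) (hu : IsWeakSolution D.Ω f u) (huh : IsGalerkinSolution S f uh)
    (r : (a : 𝒱) → L2 (D.large a)) (hr : ∀ a, IsResidualLifting S f uh a (r a))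
    (σ : (a : 𝒱) → (b : 𝒲 a) → L2Vec (D.small a b))
    (hσ : ∀ a b, IsLocalFlux S f uh a (r a) b (σ a b)) :
    MemLp (totalFlux D σ) 2 (volume.restrict D.Ω) ∧
    (∃! divσ : L2 D.Ω, HasWeakDiv D.Ω (totalFlux D σ) divσ) ∧
    ∀ divσ : L2 D.Ω, HasWeakDiv D.Ω (totalFlux D σ) divσ →
      (∃! p : L2 D.Ω, IsPGProjection D S.Qh (fun x => f x - divσ x) p) ∧
      ∀ p : L2 D.Ω, IsPGProjection D S.Qh (fun x => f x - divσ x) p →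
        normL2 D.Ω (weakGrad D.Ω (fun x => u x - uh x)) ≤
          normL2 D.Ω (fun x => totalFlux D σ x + weakGrad D.Ω uh x) +
            normHneg1 D.Ω (fun x => (f x - divσ x) - p x) := by
  choose p hp hσV hσdiv _ using hσ
  have hΩ := hsetting.isOpen
  have hmem : MemLp (totalFlux D σ) 2 (volume.restrict D.Ω) :=
    memLp_finsetSum _ fun a _ => memLp_finsetSum _ fun b _ =>
      memLp_indicator_small hvertices (Lp.memLp (σ a b))
  have hdivp : HasWeakDiv D.Ω (totalFlux D σ)
      (fun x => ∑ a, ∑ b, (D.small a b).indicator (p a b) x) :=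
    HasWeakDiv.sum _ fun a => HasWeakDiv.sum _ fun b =>
      EquilibrationSpaces.hasWeakDiv_indicator hsetting hnodes hvertices hspaces (hσV a b) (hσdiv a b)
  have hpm : MemLp (fun x => ∑ a, ∑ b, (D.small a b).indicator (p a b) x) 2
      (volume.restrict D.Ω) :=
    memLp_finsetSum _ fun a _ => memLp_finsetSum _ fun b _ =>
      memLp_indicator_small hvertices (Lp.memLp (p a b))
  refine ⟨hmem, ⟨hpm.toLp _, hdivp.congr hpm.coeFn_toLp.symm, fun g hg => ?_⟩, ?_⟩
  · exact Lp.ext ((hg.unique hΩ hdivp).trans hpm.coeFn_toLp.symm)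
  intro divσ hdiv
  -- Existence comes from exhibiting zero as the projection; `Qh` need be neither closed nor
  -- finite-dimensional.
  have h0 : IsPGProjection D S.Qh (fun x => f x - divσ x) (0 : L2 D.Ω) := by
    refine ⟨S.Qh.zero_mem, fun q hq => ?_⟩
    rw [setIntegral_residual_eq_zero hsetting hnodes hvertices hspaces huh hr hp
      (hdiv.unique hΩ hdivp) hq]
    refine integral_eq_zero_of_ae ?_
    filter_upwards [Lp.coeFn_zero ℝ 2 (volume.restrict D.Ω)] with x hx
    rw [hx]
    simp
  refine ⟨⟨0, h0, fun p' hp' => hp'.unique hsetting h0⟩, fun p' hp' => ?_⟩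
  have hp0 : p' = 0 := hp'.unique hsetting h0
  have hneg : normHneg1 D.Ω (fun x => (f x - divσ x) - p' x)
      = normHneg1 D.Ω (fun x => f x - divσ x) := by
    have hae : ∀ v : Rd d → ℝ, ∫ x in D.Ω, ((f x - divσ x) - p' x) * v x
        = ∫ x in D.Ω, (f x - divσ x) * v x := by
      intro v
      refine integral_congr_ae ?_
      filter_upwards [Lp.coeFn_zero ℝ 2 (volume.restrict D.Ω)] with x hx
      rw [hp0, hx]
      simp
    simp only [normHneg1, hae]
  rw [hneg]
  exact hu.error_le hΩ (hsetting.Vh_sub uh huh.1) hmem hdiv
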